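/- Let $G$ be a second countable locally compact (Hausdorff) group and let $\Gamma\subseteq G$ be a lattice, i.e. a closed discrete subgroup such that $G/\Gamma$ carries a nonzero bounded $G$-invariant measure. Let $\Omega\subseteq G$ be the range of a Borel cross section of the quotient map $G\to G/\Gamma$ (a fundamental domain, so that $G=\bigsqcup_{\gamma\in\Gamma}\Omega\gamma$), and let $\mu$ be the Haar measure on $G$ normalized so that $\mu(\Omega)=1$. Let $\mu_\Gamma$ be the counting measure on $\Gamma$, and for $\varphi:\Gamma\to\mathbb C$ put $$\hat\varphi=\chi_\Omega*\varphi\mu_\Gamma*\tilde\chi_\Omega,\qquad\text{i.e.}\qquad \hat\varphi(x)=\int_G\Big(\sum_{\gamma\in\Gamma}\chi_\Omega(y\gamma^{-1})\varphi(\gamma)\Big)\,\tilde\chi_\Omega(y^{-1}x)\,d\mu(y),$$ where $\tilde f(x)=\overline{f(x^{-1})}$. For a locally compact group $H$ with left regular representation $\lambda$ on $L^2(H)$ (for $H=\Gamma$: on $\ell^2(\Gamma)$), let $\mathfrak M(H)=\lambda(H)''$ be the group von Neumann algebra. The Fourier algebra $A(H)$ is the predual of $\mathfrak M(H)$, realized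 as functions on $H$ through $\omega\mapsto(x\mapsto\omega(\lambda(x)))$; that is, $A(H)$ consists of the functions $\psi(x)=\sum_n\langle\lambda(x)f_n,g_n\rangle$ with $f_n,g_n\in L^2(H)$ and $\sum_n\|f_n\|_2\|g_n\|_2<\infty$, and $\|\psi\|_{A(H)}$ is the infimum of $\sum_n\|f_n\|_2\|g_n\|_2$ over all such representations; the duality is $\langle T,\psi\rangle=\sum_n\langle Tf_n,g_n\rangle$ for $T\in\mathfrak M(H)$. The space $M_0A(H)$ of completely bounded multipliers consists of the continuous functions $\varphi$ on $H$ with $\varphi\psi\in A(H)$ for all $\psi\in A(H)$ for which the transposed operator $m_\varphi^*:\mathfrak M(H)\to\mathfrak M(H)$ of $m_\varphi:\psi\mapsto\varphi\psi$, given by $\langle m_\varphi^*T,\psi\rangle=\langle T,\varphi\psi\rangle$, is completely bounded, and $\|\varphi\|_{M_0A(H)}=\|m_\varphi^*\|_{cb}$. Then: 1. If $\varphi\in A(\Gamma)$, then $\hat\varphi\in A(G)$ and $\|\hat\varphi\|_{A(G)}\le\|\varphi\|_{A(\Gamma)}$. 2. If $\varphi\in M_0A(\Gamma)$, then $\hat\varphi\in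 M_0A(G)$ and $\|\hat\varphi\|_{M_0A(G)}\le\|\varphi\|_{M_0A(\Gamma)}$. -/

import Mathlib

open MeasureTheory
open scoped ENNReal

namespace FourierLattice

noncomputable section

section RegularRepresentation

variable {G : Type*} [Group G] [MeasurableSpace G] [MeasurableMul G]
  (μ : Measure G) [μ.IsMulLeftInvariant]

/-- The Hilbert space `L²(G, μ)` of complex square integrable functions. -/
abbrev L2 {X : Type*} [MeasurableSpace X] (μ : Measure X) : Type _ := Lp ℂ 2 μ

/-- The left regular representation `(λ(x) f)(y) = f(x⁻¹ y)` on `L²(G, μ)`. -/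
def leftReg (x : G) : L2 μ →L[ℂ] L2 μ :=
  (Lp.compMeasurePreservingₗᵢ ℂ (fun y : G => x⁻¹ * y)
    (measurePreserving_mul_left μ x⁻¹)).toContinuousLinearMap

/-- The group von Neumann algebra `M(G)` generated by the left regular representation: the
double commutant of `λ(G)` in `B(L²(G))`. (`StarSubalgebra.centralizer` is the commutant of
a set together with its adjoints.) -/
def groupVN : StarSubalgebra ℂ (L2 μ →L[ℂ] L2 μ) :=
  StarSubalgebra.centralizer ℂ
    (StarSubalgebra.centralizer ℂ (Set.range (leftReg μ)) : Set (L2 μ →L[ℂ] L2 μ))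

/-- `f, g` represent the function `φ` on `G` as a norm convergent sum of matrix coefficients of
the left regular representation: `φ(x) = ∑ₙ ⟨λ(x) fₙ, gₙ⟩` with `∑ₙ ‖fₙ‖ ‖gₙ‖ < ∞`.
In other words `T ↦ ∑ₙ ⟨T fₙ, gₙ⟩` is a normal functional on `M(G)` whose value at
`λ(x)` is `φ(x)`. (The `inner` of Mathlib is conjugate linear in its first argument.) -/
def Represents (φ : G → ℂ) (f g : ℕ → L2 μ) : Prop :=
  Summable (fun n => ‖f n‖ * ‖g n‖) ∧
    ∀ x, φ x = ∑' n, inner ℂ (g n) (leftReg μ x (f n))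

/-- The Fourier algebra `A(G)`, i.e. the predual of the group von Neumann algebra `M(G)`
realized as a space of functions on `G`: a normal functional `ω` on `M(G)` is identified with
`x ↦ ω(λ(x))`, and the normal functionals are those of the form `T ↦ ∑ₙ ⟨T fₙ, gₙ⟩` with
`∑ₙ ‖fₙ‖ ‖gₙ‖ < ∞`. -/
def fourierAlgebra : Set (G → ℂ) :=
  {φ | ∃ f g : ℕ → L2 μ, Represents μ φ f g}

/-- The norm of `A(G)`: the predual norm, which is the quotient norm of the projective tensor
norm, `‖φ‖ = inf ∑ₙ ‖fₙ‖ ‖gₙ‖` over all representations of `φ`. -/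
def fourierNorm (φ : G → ℂ) : ℝ :=
  sInf {c | ∃ f g : ℕ → L2 μ, Represents μ φ f g ∧ c = ∑' n, ‖f n‖ * ‖g n‖}

/-- `Φ : M(G) → M(G)` is the transposed `m_φ^*` of the multiplication operator
`m_φ : ψ ↦ φ ψ` on `A(G)`, i.e. `⟨Φ(T), ψ⟩ = ⟨T, φ ψ⟩` for all `T ∈ M(G)` and `ψ ∈ A(G)`, where
the duality of `M(G)` and `A(G)` is `⟨T, ψ⟩ = ∑ₙ ⟨T fₙ, gₙ⟩` for `ψ = ∑ₙ ⟨λ(·) fₙ, gₙ⟩`. -/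
def IsTransposedMul (φ : G → ℂ) (Φ : groupVN μ →ₗ[ℂ] groupVN μ) : Prop :=
  ∀ (T : groupVN μ) (ψ : G → ℂ) (f g f' g' : ℕ → L2 μ),
    Represents μ ψ f g → Represents μ (fun x => φ x * ψ x) f' g' →
      ∑' n, inner ℂ (g n) ((Φ T : L2 μ →L[ℂ] L2 μ) (f n)) =
        ∑' n, inner ℂ (g' n) ((T : L2 μ →L[ℂ] L2 μ) (f' n))

end RegularRepresentation

section CompletelyBounded

variable {H : Type*} [NormedAddCommGroup H] [InnerProductSpace ℂ H]

/-- An `n × n` matrix of operators on `H`, acting on the Hilbert space direct sum `Hⁿ` by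
`(T v)ᵢ = ∑ⱼ Tᵢⱼ vⱼ`. Its operator norm is the norm of `B(H) ⊗ Mₙ(ℂ)`. -/
def opMatrix {n : ℕ} (T : Fin n → Fin n → H →L[ℂ] H) :
    PiLp 2 (fun _ : Fin n => H) →L[ℂ] PiLp 2 (fun _ : Fin n => H) :=
  ((PiLp.continuousLinearEquiv 2 ℂ (fun _ : Fin n => H)).symm :
      (Fin n → H) →L[ℂ] PiLp 2 (fun _ : Fin n => H)) ∘L
    ContinuousLinearMap.pi (fun i => ∑ j, T i j ∘L PiLp.proj 2 (fun _ : Fin n => H) j)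

/-- The linear map `Φ` on the operator algebra `M ⊆ B(H)` is completely bounded with
`‖Φ‖_cb ≤ C`, i.e. `‖Φ ⊗ idₙ‖ ≤ C` on `M ⊗ Mₙ(ℂ)` for all `n`. -/
def CBBound [CompleteSpace H] {M : StarSubalgebra ℂ (H →L[ℂ] H)} (Φ : M →ₗ[ℂ] M) (C : ℝ) : Prop :=
  ∀ (n : ℕ) (T : Fin n → Fin n → M),
    ‖opMatrix (fun i j => (Φ (T i j) : H →L[ℂ] H))‖ ≤
      C * ‖opMatrix (fun i j => (T i j : H →L[ℂ] H))‖

end CompletelyBounded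

section Multipliers

variable {G : Type*} [Group G] [TopologicalSpace G] [MeasurableSpace G] [MeasurableMul G]
  (μ : Measure G) [μ.IsMulLeftInvariant]

/-- The multipliers `MA(G)` of the Fourier algebra. -/
def multipliers : Set (G → ℂ) :=
  {φ | Continuous φ ∧ ∀ ψ ∈ fourierAlgebra μ, (fun x => φ x * ψ x) ∈ fourierAlgebra μ}

/-- The completely bounded multipliers `M₀A(G)`: the multipliers `φ` for which the transposed
operator `m_φ^*` on `M(G)` is completely bounded. -/
def cbMultipliers : Set (G → ℂ) :=
  {φ | φ ∈ multipliers μ ∧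
    ∃ (Φ : groupVN μ →ₗ[ℂ] groupVN μ) (C : ℝ), IsTransposedMul μ φ Φ ∧ 0 ≤ C ∧ CBBound Φ C}

/-- The norm of `M₀A(G)`: the completely bounded norm of `m_φ^*`. -/
def cbMultiplierNorm (φ : G → ℂ) : ℝ :=
  sInf {C | 0 ≤ C ∧ ∃ Φ : groupVN μ →ₗ[ℂ] groupVN μ, IsTransposedMul μ φ Φ ∧ CBBound Φ C}

end Multipliers

section Lattices

variable {G : Type*} [Group G] [MeasurableSpace G]

/-- A lattice: a closed discrete subgroup `Γ` such that `G ⧸ Γ` carries a (nonzero) bounded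
`G`-invariant measure. -/
structure IsLattice [TopologicalSpace G] (Γ : Subgroup G) : Prop where
  isClosed : IsClosed (Γ : Set G)
  discrete : DiscreteTopology Γ
  exists_invariant : ∃ ν : Measure (G ⧸ Γ),
    IsFiniteMeasure ν ∧ ν ≠ 0 ∧ SMulInvariantMeasure G (G ⧸ Γ) ν

/-- `Ω` is a fundamental domain: the range of a Borel cross section of the quotient map
`G → G ⧸ Γ`. -/
def IsBorelFundamentalDomain (Γ : Subgroup G) (Ω : Set G) : Prop :=
  ∃ σ : G ⧸ Γ → G, Measurable σ ∧ (∀ q : G ⧸ Γ, (QuotientGroup.mk (σ q) : G ⧸ Γ) = q) ∧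
    Ω = Set.range σ

/-- The characteristic function of `Ω`. -/
def chi (Ω : Set G) : G → ℂ := Ω.indicator 1

/-- `f̃(x) = conj f(x⁻¹)`. -/
def tilde (f : G → ℂ) (x : G) : ℂ := starRingEnd ℂ (f x⁻¹)

/-- The convolution `f * φ μ_Γ` of a function with the measure `φ μ_Γ`, where `μ_Γ` is the
counting measure on `Γ`. -/
def convCount (Γ : Subgroup G) (f : G → ℂ) (φ : Γ → ℂ) (x : G) : ℂ :=
  ∑' γ : Γ, f (x * (γ : G)⁻¹) * φ γ

/-- The convolution `(f * g)(x) = ∫ f(y) g(y⁻¹ x) dμ(y)` of functions on `G`. -/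
def conv (μ : Measure G) (f g : G → ℂ) (x : G) : ℂ :=
  ∫ y, f y * g (y⁻¹ * x) ∂μ

/-- `φ̂ = χ_Ω * φ μ_Γ * χ̃_Ω`. -/
def hat (μ : Measure G) (Γ : Subgroup G) (Ω : Set G) (φ : Γ → ℂ) : G → ℂ :=
  conv μ (convCount Γ (chi Ω) φ) (tilde (chi Ω))

end Lattices

end

end FourierLattice

/-!
A Borel section identifies `G` with `G ⧸ Γ × Γ`, hence `L²(G)` with `L²(G ⧸ Γ) ⊗ ℓ²(Γ)`. Under this
identification `λ(x)` is the translation by `x` on `G ⧸ Γ`, twisted by `λ(α(x, ·))` where `α` is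
the cocycle of the section, and `φ̂(x)` is the mean over `G ⧸ Γ` of `φ` along the cocycle.

If `φ = ∑ₙ ⟨λ(·) fₙ, gₙ⟩`, then tensoring `fₙ` and `gₙ` with the constant function `1` yields a
representation of `φ̂` with the same bound.

If `φ` is a completely bounded multiplier, the amplification of `m_φ^*` to `B(L²(G ⧸ Γ)) ⊗ M(Γ)`
takes `λ(x)` to `w λ(x)`, where the weight `w` is given by the values of `φ` on the cocycle. As `G`
is unimodular, right translations are unitaries commuting with `λ(G)`; conjugating by them and
averaging over the fundamental domain replaces `w` by its mean `φ̂(x)`. The resulting form takes its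
values in the normal functionals, so it is `m_φ̂^*`, and each step preserves complete bounds.
-/

namespace FourierLattice

noncomputable section

open Filter Topology

section Operators

variable {H : Type*} [NormedAddCommGroup H] [InnerProductSpace ℂ H]

theorem norm_inner_apply_le (T : H →L[ℂ] H) (f g : H) :
    ‖(inner ℂ g (T f) : ℂ)‖ ≤ ‖T‖ * (‖f‖ * ‖g‖) :=
  calc ‖(inner ℂ g (T f) : ℂ)‖ ≤ ‖g‖ * ‖T f‖ := norm_inner_le_norm _ _
    _ ≤ ‖g‖ * (‖T‖ * ‖f‖) := by gcongr; exact T.le_opNorm f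
    _ = _ := by ring

theorem opNorm_le_of_norm_inner_le {T : H →L[ℂ] H} {C : ℝ} (hC : 0 ≤ C)
    (h : ∀ f g, ‖(inner ℂ g (T f) : ℂ)‖ ≤ C * (‖f‖ * ‖g‖)) : ‖T‖ ≤ C := by
  refine ContinuousLinearMap.opNorm_le_of_re_inner_le (𝕜 := ℂ) hC fun f g hf hg => ?_
  exact (RCLike.re_le_norm _).trans (by simpa [norm_inner_symm, hf, hg] using h f g)

theorem norm_normalize_le (f : H) : ‖NormedSpace.normalize f‖ ≤ 1 := by
  rcases eq_or_ne f 0 with rfl | hf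
  · simp
  · exact (NormedSpace.norm_normalize_eq_one_iff.2 hf).le

theorem coe_norm_smul_normalize (f : H) : (‖f‖ : ℂ) • NormedSpace.normalize f = f := by
  rw [Complex.coe_smul, NormedSpace.norm_smul_normalize]

variable [CompleteSpace H]

theorem exists_operator_of_form (B : H →L⋆[ℂ] H →L[ℂ] ℂ) :
    ∃ T : H →L[ℂ] H, ∀ f g, inner ℂ g (T f) = B g f :=
  ⟨ContinuousLinearMap.adjoint (InnerProductSpace.continuousLinearMapOfBilin B), fun f g => by
    rw [ContinuousLinearMap.adjoint_inner_right,
      InnerProductSpace.continuousLinearMapOfBilin_apply]⟩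

theorem subset_centralizer_centralizer (S : Set (H →L[ℂ] H)) :
    S ⊆ StarSubalgebra.centralizer ℂ (StarSubalgebra.centralizer ℂ S : Set (H →L[ℂ] H)) :=
  fun R hR => (StarSubalgebra.mem_centralizer_iff ℂ).2 fun A hA =>
    have h := (StarSubalgebra.mem_centralizer_iff ℂ).1 hA R hR
    ⟨h.1.symm, by simpa using congrArg star h.2⟩

theorem completeSpace_centralizer (S : Set (H →L[ℂ] H)) :
    CompleteSpace (StarSubalgebra.centralizer ℂ S) :=
  have h : IsClosed (StarSubalgebra.centralizer ℂ S : Set (H →L[ℂ] H)) := by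
    rw [StarSubalgebra.coe_centralizer]
    exact Set.isClosed_centralizer _
  h.completeSpace_coe

theorem mem_centralizer_of_form {S : Set (H →L[ℂ] H)} {B : H → H → ℂ} {T : H →L[ℂ] H}
    (hT : ∀ f g, inner ℂ g (T f) = B g f)
    (hB : ∀ R ∈ StarSubalgebra.centralizer ℂ (StarSubalgebra.centralizer ℂ S : Set (H →L[ℂ] H)),
      ∀ f g, B (star R g) f = B g (R f)) :
    T ∈ StarSubalgebra.centralizer ℂ S := by
  have hcomm (R) (hR : R ∈ StarSubalgebra.centralizer ℂ
      (StarSubalgebra.centralizer ℂ S : Set (H →L[ℂ] H))) : R * T = T * R := by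
    ext f
    refine ext_inner_left ℂ fun g => ?_
    simp only [mul_apply_eq_comp]
    rw [← ContinuousLinearMap.adjoint_inner_left, hT, hT, ← hB R hR,
      ContinuousLinearMap.star_eq_adjoint]
  exact (StarSubalgebra.mem_centralizer_iff ℂ).2 fun R hR =>
    ⟨hcomm R (subset_centralizer_centralizer S hR),
      hcomm _ (star_mem (subset_centralizer_centralizer S hR))⟩

end Operators

section NormalFunctionals

variable {H : Type*} [NormedAddCommGroup H] [InnerProductSpace ℂ H] [CompleteSpace H]
  (M : StarSubalgebra ℂ (H →L[ℂ] H))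

/-- The vector functionals `T ↦ ⟨T f, g⟩` on an operator algebra, as a sesquilinear map in
`(g, f)`. -/
def vectorFunctional : H →L⋆[ℂ] H →L[ℂ] (M →L[ℂ] ℂ) :=
  letI incl : M →L[ℂ] (H →L[ℂ] H) := M.toSubmodule.subtypeL
  ((ContinuousLinearMap.compL ℂ H (M →L[ℂ] H) (M →L[ℂ] ℂ)).flip incl.flip).comp
    ((ContinuousLinearMap.compL ℂ M H ℂ).comp (innerSL ℂ (E := H)))

@[simp]
theorem vectorFunctional_apply (f g : H) (T : M) :
    vectorFunctional M g f T = inner ℂ g ((T : H →L[ℂ] H) f) := rfl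

theorem norm_vectorFunctional_le (f g : H) : ‖vectorFunctional M g f‖ ≤ ‖f‖ * ‖g‖ :=
  ContinuousLinearMap.opNorm_le_bound _ (by positivity) fun T =>
    (norm_inner_apply_le (T : H →L[ℂ] H) f g).trans_eq (mul_comm _ _)

theorem norm_vectorFunctional_normalize_le (f g : H) :
    ‖vectorFunctional M (NormedSpace.normalize g) (NormedSpace.normalize f)‖ ≤ 1 :=
  (norm_vectorFunctional_le M _ _).trans
    (mul_le_one₀ (norm_normalize_le f) (norm_nonneg _) (norm_normalize_le g))

theorem smul_vectorFunctional_normalize (f g : H) :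
    ((‖f‖ * ‖g‖ : ℝ) : ℂ) •
      vectorFunctional M (NormedSpace.normalize g) (NormedSpace.normalize f) =
        vectorFunctional M g f := by
  conv_rhs => rw [← coe_norm_smul_normalize f, ← coe_norm_smul_normalize g]
  simp only [map_smulₛₗ, Complex.conj_ofReal, smul_apply, RingHom.id_apply,
    smul_smul, Complex.ofReal_mul]

theorem summable_vectorFunctional {ι : Type*} {f g : ι → H}
    (h : Summable fun i => ‖f i‖ * ‖g i‖) :
    Summable fun i => vectorFunctional M (g i) (f i) :=
  .of_norm_bounded h fun _ => norm_vectorFunctional_le M _ _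

theorem tsum_vectorFunctional_apply {ι : Type*} {f g : ι → H}
    (h : Summable fun i => ‖f i‖ * ‖g i‖) (T : M) :
    (∑' i, vectorFunctional M (g i) (f i)) T = ∑' i, inner ℂ (g i) ((T : H →L[ℂ] H) (f i)) :=
  (ContinuousLinearMap.apply ℂ ℂ T).map_tsum (summable_vectorFunctional M h)

/-- The map `ℓ¹(H × H) → M^*` which takes the basis vector at `(f, g)` to the functional
`T ↦ ⟨T f, g⟩` with `f` and `g` normalized; its range is the predual of `M`. -/
def sumFunctionals : lp (fun _ : H × H => ℂ) 1 →L[ℂ] (M →L[ℂ] ℂ) :=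
  lp.tsumCLM ℂ (H × H) (M →L[ℂ] ℂ) ∘L
    lp.mapCLM 1 (fun s : H × H => ContinuousLinearMap.toSpanSingleton ℂ
      (vectorFunctional M (NormedSpace.normalize s.2) (NormedSpace.normalize s.1)))
      zero_le_one fun s => by
        rw [ContinuousLinearMap.norm_toSpanSingleton]
        exact norm_vectorFunctional_normalize_le M s.1 s.2

theorem sumFunctionals_apply (z : lp (fun _ : H × H => ℂ) 1) :
    sumFunctionals M z = ∑' s, vectorFunctional M (NormedSpace.normalize s.2)
      (z s • NormedSpace.normalize s.1) := by
  simp [sumFunctionals]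

/-- The normal functionals on `M`, i.e. the absolutely convergent sums of vector functionals. -/
def normalFunctionals : Submodule ℂ (M →L[ℂ] ℂ) := (sumFunctionals M).range

theorem sumFunctionals_single [DecidableEq (H × H)] (f g : H) (c : ℂ) :
    sumFunctionals M (lp.single 1 (f, g) c) =
      c • vectorFunctional M (NormedSpace.normalize g) (NormedSpace.normalize f) := by
  rw [sumFunctionals_apply, tsum_eq_single (f, g)]
  · simp
  · intro s hs
    rw [lp.single_apply_ne _ _ _ hs]
    exact congrArg (vectorFunctional M _) (zero_smul ℂ _) |>.trans (map_zero _)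

theorem vectorFunctional_mem_normalFunctionals (f g : H) :
    vectorFunctional M g f ∈ normalFunctionals M := by
  classical
  exact ⟨lp.single 1 (f, g) ((‖f‖ * ‖g‖ : ℝ) : ℂ),
    (sumFunctionals_single M f g _).trans (smul_vectorFunctional_normalize M f g)⟩

theorem extend_zero_extend_zero {ι κ E F : Type*} [Zero E] [Zero F] {j : ι → κ}
    (hj : j.Injective) {b : E → E → F} (hb : b 0 0 = 0) (f g : ι → E) :
    (fun n => b (Function.extend j f 0 n) (Function.extend j g 0 n)) =
      Function.extend j (fun i => b (f i) (g i)) 0 := by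
  funext n
  by_cases hn : ∃ a, j a = n
  · obtain ⟨a, rfl⟩ := hn
    simp [hj.extend_apply]
  · simp [Function.extend_apply' _ _ _ hn, hb]

theorem exists_nat_reindex {ι : Type*} {f g : ι → H} (h : Summable fun i => ‖f i‖ * ‖g i‖) :
    ∃ f' g' : ℕ → H, Summable (fun n => ‖f' n‖ * ‖g' n‖) ∧
      ∑' n, vectorFunctional M (g' n) (f' n) = ∑' i, vectorFunctional M (g i) (f i) := by
  obtain ⟨j, hj⟩ := Set.countable_iff_exists_injective.1 h.countable_support
  refine ⟨Function.extend j (fun i => f i) 0, Function.extend j (fun i => g i) 0, ?_, ?_⟩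
  · rw [extend_zero_extend_zero hj (b := fun u v => ‖u‖ * ‖v‖) (by simp)]
    exact (summable_extend_zero hj).2 (h.subtype _)
  · rw [extend_zero_extend_zero hj (b := fun u v => vectorFunctional M v u) (by simp),
      tsum_extend_zero hj]
    refine tsum_subtype_eq_of_support_subset (f := fun i => vectorFunctional M (g i) (f i))
      fun i hi h0 => hi ?_
    rcases mul_eq_zero.1 h0 with h0 | h0 <;> simp [norm_eq_zero.1 h0]

theorem summable_norm_lp_one {α : Type*} (z : lp (fun _ : α => ℂ) 1) :
    Summable fun s => ‖z s‖ := by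
  simpa using (lp.memℓp z).summable (by simp)

variable {M}

theorem exists_eq_tsum_vectorFunctional {ω : M →L[ℂ] ℂ} (hω : ω ∈ normalFunctionals M) :
    ∃ f g : ℕ → H, Summable (fun n => ‖f n‖ * ‖g n‖) ∧
      ω = ∑' n, vectorFunctional M (g n) (f n) := by
  obtain ⟨z, hz⟩ := hω
  have hs : Summable fun s : H × H =>
      ‖z s • NormedSpace.normalize s.1‖ * ‖NormedSpace.normalize s.2‖ := by
    refine (summable_norm_lp_one z).of_nonneg_of_le (fun _ => by positivity) fun s => ?_
    rw [norm_smul, mul_assoc]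
    exact mul_le_of_le_one_right (norm_nonneg _)
      (mul_le_one₀ (norm_normalize_le _) (norm_nonneg _) (norm_normalize_le _))
  obtain ⟨f, g, hfg, h⟩ := exists_nat_reindex M hs
  exact ⟨f, g, hfg, by rw [h, ← sumFunctionals_apply]; exact hz.symm⟩

theorem exists_form_of_ker_le (L : lp (fun _ : H × H => ℂ) 1 →L[ℂ] ℂ)
    (hL : (sumFunctionals M).ker ≤ L.ker) :
    ∃ l : (M →L[ℂ] ℂ) →ₗ[ℂ] ℂ, (∀ z, l (sumFunctionals M z) = L z) ∧
      ∀ f g, ‖l (vectorFunctional M g f)‖ ≤ ‖L‖ * (‖f‖ * ‖g‖) := by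
  classical
  obtain ⟨l, hl⟩ : L.toLinearMap ∈ (sumFunctionals M).toLinearMap.dualMap.range := by
    rw [LinearMap.range_dualMap_eq_dualAnnihilator_ker, Submodule.mem_dualAnnihilator]
    exact hL
  replace hl (z) : l (sumFunctionals M z) = L z := LinearMap.congr_fun hl z
  refine ⟨l, hl, fun f g => ?_⟩
  rw [← smul_vectorFunctional_normalize, ← sumFunctionals_single, hl]
  refine (L.le_opNorm _).trans_eq ?_
  rw [lp.norm_single one_pos]
  simp

/-- A commutant `M` is the dual of its normal functionals. -/
theorem exists_eval_of_ker_le {S : Set (H →L[ℂ] H)} (hM : M = StarSubalgebra.centralizer ℂ S)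
    (L : lp (fun _ : H × H => ℂ) 1 →L[ℂ] ℂ) (hL : (sumFunctionals M).ker ≤ L.ker) :
    ∃ T : M, ‖T‖ ≤ ‖L‖ ∧ ∀ z, sumFunctionals M z T = L z := by
  classical
  obtain ⟨l, hl, hbound⟩ := exists_form_of_ker_le L hL
  obtain ⟨T, hT⟩ := exists_operator_of_form (LinearMap.mkContinuous₂
    (LinearMap.mk₂'ₛₗ (starRingEnd ℂ) (RingHom.id ℂ) (fun g f => l (vectorFunctional M g f))
      (by simp) (by simp) (by simp) (by simp)) ‖L‖
    fun g f => (hbound f g).trans_eq (by ring))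
  replace hT (f g) : inner ℂ g (T f) = l (vectorFunctional M g f) := hT f g
  have hTM : T ∈ M := by
    subst hM
    refine mem_centralizer_of_form hT fun R hR f g => congrArg l ?_
    ext A
    have hA := congrArg (fun B : H →L[ℂ] H => B f)
      ((StarSubalgebra.mem_centralizer_iff ℂ).1 hR A A.2).1
    simpa [ContinuousLinearMap.star_eq_adjoint, ContinuousLinearMap.adjoint_inner_left]
      using congrArg (inner ℂ g) hA.symm
  refine ⟨⟨T, hTM⟩, opNorm_le_of_norm_inner_le (norm_nonneg _) fun f g => ?_, fun z => ?_⟩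
  · exact (congrArg norm (hT f g)).trans_le (hbound f g)
  · refine congrArg (fun K : lp (fun _ : H × H => ℂ) 1 →L[ℂ] ℂ => K z)
      (lp.ext_continuousLinearMap (f := ContinuousLinearMap.apply ℂ ℂ (⟨T, hTM⟩ : M) ∘L
        sumFunctionals M) (g := L) (by simp) fun s => ?_)
    ext
    change sumFunctionals M (lp.single 1 (s.1, s.2) 1) ⟨T, hTM⟩ = L (lp.single 1 (s.1, s.2) 1)
    rw [← hl, sumFunctionals_single, one_smul, ← hT]
    rfl

theorem isClosed_normalFunctionals {S : Set (H →L[ℂ] H)}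
    (hM : M = StarSubalgebra.centralizer ℂ S) :
    IsClosed (normalFunctionals M : Set (M →L[ℂ] ℂ)) := by
  let K : Submodule ℂ (lp (fun _ : H × H => ℂ) 1) := (sumFunctionals M).ker
  have : IsClosed (K : Set (lp (fun _ : H × H => ℂ) 1)) := (sumFunctionals M).isClosed_ker
  let q : (lp (fun _ : H × H => ℂ) 1 ⧸ K) →L[ℂ] (M →L[ℂ] ℂ) :=
    K.liftQL (sumFunctionals M) le_rfl
  -- The predual norm is the norm of functionals on `M`, since `M` contains the dual unit ball.
  have hq : AntilipschitzWith 1 q := by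
    refine AddMonoidHomClass.antilipschitz_of_bound q fun x => ?_
    obtain ⟨z, rfl⟩ := K.mkQ_surjective x
    obtain ⟨l, hl, hlz⟩ := exists_dual_vector'' ℂ (K.mkQ z)
    obtain ⟨T, hT, hTl⟩ := exists_eval_of_ker_le hM (l ∘L K.mkQL) fun w hw =>
      (congrArg l ((Submodule.Quotient.mk_eq_zero K).2 hw)).trans (map_zero l)
    have hl1 : ‖l ∘L K.mkQL‖ ≤ 1 := ContinuousLinearMap.opNorm_le_bound _ zero_le_one fun w =>
      (l.le_of_opNorm_le hl _).trans (by gcongr; exact Submodule.Quotient.norm_mk_le K w)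
    calc ‖K.mkQ z‖ = ‖q (K.mkQ z) T‖ := by
          rw [show q (K.mkQ z) T = ‖K.mkQ z‖ from (hTl z).trans hlz]
          simp
      _ ≤ ‖q (K.mkQ z)‖ * ‖T‖ := ContinuousLinearMap.le_opNorm _ _
      _ ≤ 1 * ‖q (K.mkQ z)‖ := by
          rw [one_mul]
          exact mul_le_of_le_one_right (norm_nonneg _) (hT.trans hl1)
  have hrange : (normalFunctionals M : Set (M →L[ℂ] ℂ)) = Set.range q :=
    congrArg SetLike.coe (K.range_liftQ (sumFunctionals M).toLinearMap le_rfl).symm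
  rw [hrange]
  exact hq.isClosed_range q.uniformContinuous

theorem tsum_mem_normalFunctionals {S : Set (H →L[ℂ] H)}
    (hM : M = StarSubalgebra.centralizer ℂ S) {ι : Type*} {ω : ι → M →L[ℂ] ℂ}
    (hω : ∀ i, ω i ∈ normalFunctionals M) (hs : Summable ω) :
    ∑' i, ω i ∈ normalFunctionals M :=
  (isClosed_normalFunctionals hM).mem_of_tendsto hs.hasSum
    (Eventually.of_forall fun _ => Submodule.sum_mem _ fun i _ => hω i)

end NormalFunctionals

section DoubleCommutant

variable {ι H : Type*} [NormedAddCommGroup H] [InnerProductSpace ℂ H]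

/-- The diagonal amplification of an operator to `ℓ²(ι, H)`. -/
def diagonal (ι : Type*) (A : H →L[ℂ] H) :
    lp (fun _ : ι => H) 2 →L[ℂ] lp (fun _ : ι => H) 2 :=
  lp.mapCLM 2 (fun _ => A) (norm_nonneg A) fun _ => le_rfl

@[simp]
theorem diagonal_apply (A : H →L[ℂ] H) (ξ : lp (fun _ : ι => H) 2) (i : ι) :
    diagonal ι A ξ i = A (ξ i) := by
  simp [diagonal]

theorem diagonal_single [DecidableEq ι] (A : H →L[ℂ] H) (i : ι) (f : H) :
    diagonal ι A (lp.single 2 i f) = lp.single 2 i (A f) := by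
  ext j
  rw [diagonal_apply]
  rcases eq_or_ne j i with rfl | h
  · simp
  · simp [h]

theorem exists_inner_diagonal_eq_tsum {f g : ι → H} (h : Summable fun i => ‖f i‖ * ‖g i‖) :
    ∃ ξ η : lp (fun _ : ι => H) 2, ∀ A : H →L[ℂ] H,
      inner ℂ η (diagonal ι A ξ) = ∑' i, inner ℂ (g i) (A (f i)) := by
  let r (i : ι) : ℂ := (√(‖f i‖ * ‖g i‖) : ℝ)
  have hr (i) : r i * r i = ‖f i‖ * ‖g i‖ := by
    rw [← Complex.ofReal_mul, Real.mul_self_sqrt (by positivity), Complex.ofReal_mul]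
  have hmem (u : ι → H) : Memℓp (fun i => r i • NormedSpace.normalize (u i)) 2 := by
    refine memℓp_gen (h.of_nonneg_of_le (fun _ => by positivity) fun i => ?_)
    calc ‖r i • NormedSpace.normalize (u i)‖ ^ (2 : ℝ≥0∞).toReal
        = ‖r i • NormedSpace.normalize (u i)‖ ^ 2 := by simp
      _ ≤ ‖r i‖ ^ 2 := by
          rw [norm_smul]
          gcongr
          exact mul_le_of_le_one_right (norm_nonneg _) (norm_normalize_le _)
      _ = ‖f i‖ * ‖g i‖ := by rw [sq, ← norm_mul, hr]; simp
  refine ⟨⟨_, hmem f⟩, ⟨_, hmem g⟩, fun A => ?_⟩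
  rw [lp.inner_eq_tsum]
  refine tsum_congr fun i => ?_
  conv_rhs => rw [← coe_norm_smul_normalize (f i), ← coe_norm_smul_normalize (g i)]
  simp only [diagonal_apply, map_smul, inner_smul_left, inner_smul_right, Complex.conj_ofReal, r]
    at hr ⊢
  linear_combination
    inner ℂ (NormedSpace.normalize (g i)) (A (NormedSpace.normalize (f i))) * hr i

variable [CompleteSpace H]

theorem adjoint_diagonal (A : H →L[ℂ] H) :
    ContinuousLinearMap.adjoint (diagonal ι A) = diagonal ι (star A) := by
  refine ((ContinuousLinearMap.eq_adjoint_iff _ _).2 fun η ξ => ?_).symm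
  rw [lp.inner_eq_tsum, lp.inner_eq_tsum]
  simp [ContinuousLinearMap.star_eq_adjoint, ContinuousLinearMap.adjoint_inner_left]

theorem commute_starProjection {K : Submodule ℂ H} [K.HasOrthogonalProjection] {A : H →L[ℂ] H}
    (hK : ∀ f ∈ K, A f ∈ K) (hK' : ∀ f ∈ K, ContinuousLinearMap.adjoint A f ∈ K) :
    Commute K.starProjection A := by
  refine (ContinuousLinearMap.IsIdempotentElem.commute_iff
    K.isIdempotentElem_starProjection).2 ⟨?_, ?_⟩
  · rw [Submodule.range_starProjection]
    exact hK
  · rw [Submodule.ker_starProjection]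
    exact ContinuousLinearMap.orthogonal_mem_invtSubmodule hK'

theorem commute_diagonal_of_mem_doubleCommutant {S : Set (H →L[ℂ] H)}
    (hstar : ∀ A ∈ S, star A ∈ S) {P : lp (fun _ : ι => H) 2 →L[ℂ] lp (fun _ : ι => H) 2}
    (hP : ∀ A ∈ S, Commute P (diagonal ι A)) {T : H →L[ℂ] H}
    (hT : T ∈ StarSubalgebra.centralizer ℂ
      (StarSubalgebra.centralizer ℂ S : Set (H →L[ℂ] H))) :
    Commute P (diagonal ι T) := by
  classical
  let R (j i : ι) : H →L[ℂ] H := lp.evalCLM ℂ (fun _ : ι => H) 2 j ∘L P ∘L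
    lp.singleContinuousLinearMap ℂ (fun _ : ι => H) 2 i
  have hR (j i f) : R j i f = P (lp.single 2 i f) j := rfl
  have hcomm (j i A) (hA : A ∈ S) : A * R j i = R j i * A := by
    ext f
    rw [mul_apply_eq_comp, mul_apply_eq_comp, hR, hR, ← diagonal_single, ← diagonal_apply]
    exact congrArg (fun B : lp (fun _ : ι => H) 2 →L[ℂ] lp (fun _ : ι => H) 2 =>
      B (lp.single 2 i f) j) (hP A hA).eq.symm
  have hRS (j i) : R j i ∈ StarSubalgebra.centralizer ℂ S :=
    (StarSubalgebra.mem_centralizer_iff ℂ).2 fun A hA =>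
      ⟨hcomm j i A hA, hcomm j i _ (hstar A hA)⟩
  refine lp.ext_continuousLinearMap (by simp) fun i => ?_
  ext f j
  change P (diagonal ι T (lp.single 2 i f)) j = diagonal ι T (P (lp.single 2 i f)) j
  rw [diagonal_single, diagonal_apply, ← hR, ← hR]
  exact congrArg (fun B : H →L[ℂ] H => B f)
    ((StarSubalgebra.mem_centralizer_iff ℂ).1 hT (R j i) (hRS j i)).1

theorem inner_diagonal_eq_zero {S : Submonoid (H →L[ℂ] H)} (hstar : ∀ A ∈ S, star A ∈ S)
    {T : H →L[ℂ] H} (hT : T ∈ StarSubalgebra.centralizer ℂ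
      (StarSubalgebra.centralizer ℂ (S : Set (H →L[ℂ] H)) : Set (H →L[ℂ] H)))
    {ξ η : lp (fun _ : ι => H) 2} (h : ∀ A ∈ S, inner ℂ η (diagonal ι A ξ) = 0) :
    inner ℂ η (diagonal ι T ξ) = 0 := by
  let K : Submodule ℂ (lp (fun _ : ι => H) 2) :=
    (Submodule.span ℂ ((fun A => diagonal ι A ξ) '' S)).topologicalClosure
  have hgen (A) (hA : A ∈ S) : diagonal ι A ξ ∈ K :=
    Submodule.le_topologicalClosure _ (Submodule.subset_span ⟨A, hA, rfl⟩)
  have hmin {N : Submodule ℂ (lp (fun _ : ι => H) 2)}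
      (hN : IsClosed (N : Set (lp (fun _ : ι => H) 2)))
      (hSN : ∀ A ∈ S, diagonal ι A ξ ∈ N) : K ≤ N :=
    Submodule.topologicalClosure_minimal _ (Submodule.span_le.2 (Set.image_subset_iff.2 hSN)) hN
  have hclosed : IsClosed (K : Set (lp (fun _ : ι => H) 2)) :=
    Submodule.isClosed_topologicalClosure _
  have : CompleteSpace K := hclosed.completeSpace_coe
  have hinv (A) (hA : A ∈ S) (ζ) (hζ : ζ ∈ K) : diagonal ι A ζ ∈ K := by
    refine hmin (N := K.comap (diagonal ι A).toLinearMap)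
      (hclosed.preimage (diagonal ι A).continuous) (fun B hB => ?_) hζ
    have hAB : diagonal ι A (diagonal ι B ξ) = diagonal ι (A * B) ξ := by ext i; simp
    exact Submodule.mem_comap.2 (hAB ▸ hgen _ (S.mul_mem hA hB))
  have hcomm : Commute K.starProjection (diagonal ι T) :=
    commute_diagonal_of_mem_doubleCommutant hstar (fun A hA => commute_starProjection (hinv A hA)
      (adjoint_diagonal A ▸ hinv _ (hstar A hA))) hT
  have hξ : ξ ∈ K := by
    have h1 : diagonal ι (1 : H →L[ℂ] H) ξ = ξ := by ext i; simp
    exact h1 ▸ hgen 1 S.one_mem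
  have hTξ : diagonal ι T ξ ∈ K := by
    rw [← Submodule.starProjection_eq_self_iff (K := K)]
    calc K.starProjection (diagonal ι T ξ) = diagonal ι T (K.starProjection ξ) :=
          congrArg (fun B : lp (fun _ : ι => H) 2 →L[ℂ] lp (fun _ : ι => H) 2 => B ξ) hcomm.eq
      _ = diagonal ι T ξ := by rw [Submodule.starProjection_eq_self_iff.2 hξ]
  exact hmin (N := (innerSL ℂ η).ker) (innerSL ℂ η).isClosed_ker h hTξ

theorem eq_zero_of_forall_mem_submonoid {M : StarSubalgebra ℂ (H →L[ℂ] H)}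
    {S : Submonoid (H →L[ℂ] H)} (hstar : ∀ A ∈ S, star A ∈ S)
    (hM : M = StarSubalgebra.centralizer ℂ
      (StarSubalgebra.centralizer ℂ (S : Set (H →L[ℂ] H)) : Set (H →L[ℂ] H)))
    {ω : M →L[ℂ] ℂ} (hω : ω ∈ normalFunctionals M)
    (h : ∀ A : M, (A : H →L[ℂ] H) ∈ S → ω A = 0) : ω = 0 := by
  obtain ⟨f, g, hfg, rfl⟩ := exists_eq_tsum_vectorFunctional hω
  obtain ⟨ξ, η, hξη⟩ := exists_inner_diagonal_eq_tsum hfg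
  have happly (T : M) : (∑' n, vectorFunctional M (g n) (f n)) T =
      inner ℂ η (diagonal ℕ (T : H →L[ℂ] H) ξ) :=
    (tsum_vectorFunctional_apply M hfg T).trans (hξη T).symm
  have hzero (A) (hA : A ∈ S) : inner ℂ η (diagonal ℕ A ξ) = 0 :=
    have hAM : A ∈ M := hM.ge (subset_centralizer_centralizer _ hA)
    (happly ⟨A, hAM⟩).symm.trans (h ⟨A, hAM⟩ hA)
  ext T
  exact (happly T).trans (inner_diagonal_eq_zero hstar (hM.le T.2) hzero)

end DoubleCommutant

section LeftRegular

variable {G : Type*} [Group G] [MeasurableSpace G] [MeasurableMul G]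
  (μ : Measure G) [μ.IsMulLeftInvariant]

theorem coeFn_leftReg (x : G) (f : L2 μ) : leftReg μ x f =ᵐ[μ] fun y => f (x⁻¹ * y) :=
  Lp.coeFn_compMeasurePreserving f (measurePreserving_mul_left μ x⁻¹)

@[simp]
theorem norm_leftReg_apply (x : G) (f : L2 μ) : ‖leftReg μ x f‖ = ‖f‖ :=
  (Lp.compMeasurePreservingₗᵢ ℂ (fun y : G => x⁻¹ * y)
    (measurePreserving_mul_left μ x⁻¹)).norm_map f

theorem norm_leftReg_le (x : G) : ‖leftReg μ x‖ ≤ 1 :=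
  LinearIsometry.norm_toContinuousLinearMap_le _

/-- The left regular representation as a homomorphism. -/
def leftRegHom : G →* (L2 μ →L[ℂ] L2 μ) where
  toFun := leftReg μ
  map_one' := by
    ext1 f
    refine Lp.ext ?_
    filter_upwards [coeFn_leftReg μ 1 f] with y hy
    simp [hy]
  map_mul' x y := by
    ext1 f
    refine Lp.ext ?_
    have h := (measurePreserving_mul_left μ x⁻¹).quasiMeasurePreserving.ae (coeFn_leftReg μ y f)
    filter_upwards [coeFn_leftReg μ (x * y) f, coeFn_leftReg μ x (leftReg μ y f), h]
      with z h1 h2 h3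
    rw [h1, mul_apply_eq_comp, h2, h3, mul_inv_rev, mul_assoc]

theorem star_leftReg (x : G) : star (leftReg μ x) = leftReg μ x⁻¹ := by
  have hiso (f g : L2 μ) : inner ℂ (leftReg μ x f) (leftReg μ x g) = inner ℂ f g :=
    (Lp.compMeasurePreservingₗᵢ (E := ℂ) (p := 2) ℂ (fun y => x⁻¹ * y)
      (measurePreserving_mul_left μ x⁻¹)).inner_map_map f g
  refine ((ContinuousLinearMap.eq_adjoint_iff _ _).2 fun f g => ?_).symm
  calc inner ℂ (leftReg μ x⁻¹ f) g
      = inner ℂ (leftReg μ x (leftReg μ x⁻¹ f)) (leftReg μ x g) := (hiso _ _).symm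
    _ = inner ℂ (leftRegHom μ (x * x⁻¹) f) (leftReg μ x g) := by rw [map_mul]; rfl
    _ = inner ℂ f (leftReg μ x g) := by rw [mul_inv_cancel, map_one]; rfl

/-- The left regular representation with values in the group von Neumann algebra. -/
def leftRegVN (x : G) : groupVN μ :=
  ⟨leftReg μ x, subset_centralizer_centralizer _ ⟨x, rfl⟩⟩

@[simp]
theorem coe_leftRegVN (x : G) : (leftRegVN μ x : L2 μ →L[ℂ] L2 μ) = leftReg μ x := rfl

variable {μ}

theorem inner_star_apply_leftReg {R : L2 μ →L[ℂ] L2 μ}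
    (hR : R ∈ StarSubalgebra.centralizer ℂ (groupVN μ : Set (L2 μ →L[ℂ] L2 μ))) (x : G)
    (f g : L2 μ) : inner ℂ (star R g) (leftReg μ x f) = inner ℂ g (leftReg μ x (R f)) := by
  have hx := ((StarSubalgebra.mem_centralizer_iff ℂ).1 hR _ (leftRegVN μ x).2).1
  rw [ContinuousLinearMap.star_eq_adjoint, ContinuousLinearMap.adjoint_inner_left]
  exact congrArg (inner ℂ g) (DFunLike.congr_fun hx.symm f)

theorem normalFunctional_ext {ω ω' : groupVN μ →L[ℂ] ℂ} (hω : ω ∈ normalFunctionals (groupVN μ))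
    (hω' : ω' ∈ normalFunctionals (groupVN μ))
    (h : ∀ x, ω (leftRegVN μ x) = ω' (leftRegVN μ x)) : ω = ω' := by
  refine sub_eq_zero.1 (eq_zero_of_forall_mem_submonoid (S := MonoidHom.mrange (leftRegHom μ)) ?_
    rfl (Submodule.sub_mem _ hω hω') ?_)
  · rintro _ ⟨x, rfl⟩
    exact ⟨x⁻¹, (star_leftReg μ x).symm⟩
  · rintro ⟨_, hA⟩ ⟨x, rfl⟩
    exact sub_eq_zero.2 (h x)

theorem Represents.exists_normalFunctional {φ : G → ℂ} {f g : ℕ → L2 μ}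
    (h : Represents μ φ f g) : ∃ ω ∈ normalFunctionals (groupVN μ),
      (∀ T, ω T = ∑' n, inner ℂ (g n) ((T : L2 μ →L[ℂ] L2 μ) (f n))) ∧
        ∀ x, ω (leftRegVN μ x) = φ x :=
  ⟨∑' n, vectorFunctional (groupVN μ) (g n) (f n),
    tsum_mem_normalFunctionals rfl (fun _ => vectorFunctional_mem_normalFunctionals _ _ _)
      (summable_vectorFunctional _ h.1),
    tsum_vectorFunctional_apply _ h.1,
    fun x => (tsum_vectorFunctional_apply _ h.1 _).trans (h.2 x).symm⟩

theorem exists_represents {ω : groupVN μ →L[ℂ] ℂ} (hω : ω ∈ normalFunctionals (groupVN μ)) :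
    ∃ f g : ℕ → L2 μ, Represents μ (fun x => ω (leftRegVN μ x)) f g := by
  obtain ⟨f, g, hfg, rfl⟩ := exists_eq_tsum_vectorFunctional hω
  exact ⟨f, g, hfg, fun x => tsum_vectorFunctional_apply _ hfg _⟩

theorem mem_fourierAlgebra_iff {φ : G → ℂ} : φ ∈ fourierAlgebra μ ↔
    ∃ ω ∈ normalFunctionals (groupVN μ), ∀ x, ω (leftRegVN μ x) = φ x := by
  constructor
  · rintro ⟨f, g, h⟩
    obtain ⟨ω, hω, -, hωφ⟩ := h.exists_normalFunctional
    exact ⟨ω, hω, hωφ⟩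
  · rintro ⟨ω, hω, h⟩
    rw [← funext h]
    exact exists_represents hω

theorem isTransposedMul_iff {φ : G → ℂ} {Φ : groupVN μ →ₗ[ℂ] groupVN μ} :
    IsTransposedMul μ φ Φ ↔ ∀ ω ∈ normalFunctionals (groupVN μ),
      ∀ ω' ∈ normalFunctionals (groupVN μ),
        (∀ x, ω' (leftRegVN μ x) = φ x * ω (leftRegVN μ x)) → ∀ T, ω (Φ T) = ω' T := by
  constructor
  · intro h ω hω ω' hω' heq T
    obtain ⟨f, g, hfg, rfl⟩ := exists_eq_tsum_vectorFunctional hω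
    obtain ⟨f', g', hfg', rfl⟩ := exists_eq_tsum_vectorFunctional hω'
    calc _ = ∑' n, inner ℂ (g n) ((Φ T : L2 μ →L[ℂ] L2 μ) (f n)) :=
          tsum_vectorFunctional_apply _ hfg _
      _ = ∑' n, inner ℂ (g' n) ((T : L2 μ →L[ℂ] L2 μ) (f' n)) :=
          h T _ f g f' g' ⟨hfg, fun x => tsum_vectorFunctional_apply _ hfg (leftRegVN μ x)⟩
            ⟨hfg', fun x => (heq x).symm.trans (tsum_vectorFunctional_apply _ hfg' _)⟩
      _ = _ := (tsum_vectorFunctional_apply _ hfg' _).symm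
  · intro h T ψ f g f' g' hψ hψ'
    obtain ⟨ω, hω, hωT, hωψ⟩ := hψ.exists_normalFunctional
    obtain ⟨ω', hω', hω'T, hω'ψ⟩ := hψ'.exists_normalFunctional
    rw [← hωT, ← hω'T]
    exact h ω hω ω' hω' (fun x => by rw [hω'ψ, hωψ]) T

end LeftRegular

section FormBound

variable {κ κ' : Type*} [Fintype κ] [Fintype κ'] {H : Type*} [NormedAddCommGroup H]

/-- The matrix `B` of forms on `H` is bounded by `c` as a form on the Hilbert space direct sum
`H^κ`. -/
def FormBound (B : κ → κ → H → H → ℂ) (c : ℝ) : Prop :=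
  ∀ v u : PiLp 2 fun _ : κ => H, ‖∑ k, ∑ l, B k l (v k) (u l)‖ ≤ c * (‖u‖ * ‖v‖)

theorem formBound_of_unique [Unique κ] {B : κ → κ → H → H → ℂ} {c : ℝ} :
    FormBound B c ↔ ∀ v u, ‖B default default v u‖ ≤ c * (‖u‖ * ‖v‖) := by
  have hnorm (u : PiLp 2 fun _ : κ => H) : ‖u‖ = ‖u default‖ := by simp [PiLp.norm_eq_of_L2]
  simp only [FormBound, Fintype.sum_unique, hnorm]
  exact ⟨fun h v u => h (WithLp.toLp 2 fun _ => v) (WithLp.toLp 2 fun _ => u),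
    fun h v u => h _ _⟩

variable [InnerProductSpace ℂ H]

theorem FormBound.reindex {B : κ → κ → H → H → ℂ} {c : ℝ} (h : FormBound B c) (e : κ' ≃ κ) :
    FormBound (fun k l => B (e k) (e l)) c := by
  intro v u
  have he := h (LinearIsometryEquiv.piLpCongrLeft 2 ℂ H e v)
    (LinearIsometryEquiv.piLpCongrLeft 2 ℂ H e u)
  rw [LinearIsometryEquiv.norm_map, LinearIsometryEquiv.norm_map, ← e.sum_comp] at he
  simpa only [← e.sum_comp (fun l => B _ l _ _), LinearIsometryEquiv.piLpCongrLeft_apply,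
    Equiv.piCongrLeft'_apply, Equiv.symm_apply_apply] using he

/-- The matrix of forms `(v, u) ↦ ⟨v, T k l u⟩` of a matrix of operators. -/
def operatorForm (T : κ → κ → H →L[ℂ] H) (k l : κ) (v u : H) : ℂ := inner ℂ v (T k l u)

theorem inner_opMatrix {n : ℕ} (T : Fin n → Fin n → H →L[ℂ] H)
    (v u : PiLp 2 fun _ : Fin n => H) :
    inner ℂ v (opMatrix T u) = ∑ k, ∑ l, operatorForm T k l (v k) (u l) := by
  rw [PiLp.inner_apply]
  refine Finset.sum_congr rfl fun k _ => ?_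
  simp only [operatorForm, ← inner_sum]
  congr 1
  simp [opMatrix]

theorem norm_opMatrix_le_iff {n : ℕ} {T : Fin n → Fin n → H →L[ℂ] H} {c : ℝ} (hc : 0 ≤ c) :
    ‖opMatrix T‖ ≤ c ↔ FormBound (operatorForm T) c := by
  constructor
  · intro h v u
    rw [← inner_opMatrix]
    exact (norm_inner_apply_le _ _ _).trans (by gcongr)
  · intro h
    refine opNorm_le_of_norm_inner_le hc fun u v => ?_
    rw [inner_opMatrix]
    exact h v u

theorem formBound_operatorForm_unit (T : H →L[ℂ] H) :
    FormBound (operatorForm fun _ _ : Unit => T) ‖T‖ :=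
  formBound_of_unique.2 fun v u => norm_inner_apply_le T u v

variable [CompleteSpace H] {M : StarSubalgebra ℂ (H →L[ℂ] H)} {Φ : M →ₗ[ℂ] M} {C : ℝ}

theorem CBBound.formBound (hC : 0 ≤ C) (hΦ : CBBound Φ C) {T : κ → κ → M} {c : ℝ} (hc : 0 ≤ c)
    (hT : FormBound (operatorForm fun k l => (T k l : H →L[ℂ] H)) c) :
    FormBound (operatorForm fun k l => (Φ (T k l) : H →L[ℂ] H)) (C * c) := by
  let e := Fintype.equivFin κ
  have hnorm : ‖opMatrix fun k l => (T (e.symm k) (e.symm l) : H →L[ℂ] H)‖ ≤ c :=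
    (norm_opMatrix_le_iff hc).2 (hT.reindex e.symm)
  have hΦT := (norm_opMatrix_le_iff (mul_nonneg hC hc)).1
    ((hΦ _ fun k l => T (e.symm k) (e.symm l)).trans (mul_le_mul_of_nonneg_left hnorm hC))
  intro v u
  simpa only [operatorForm, Equiv.symm_apply_apply] using hΦT.reindex e v u

theorem CBBound.norm_apply_le (hC : 0 ≤ C) (hΦ : CBBound Φ C) (T : M) : ‖Φ T‖ ≤ C * ‖T‖ :=
  opNorm_le_of_norm_inner_le (by positivity) fun u v => formBound_of_unique.1
    (hΦ.formBound hC (norm_nonneg _) (formBound_operatorForm_unit (T : H →L[ℂ] H))) v u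

end FormBound

section Amplification

variable {ι K H : Type*} [NormedAddCommGroup K] [InnerProductSpace ℂ K] [CompleteSpace K]
  [NormedAddCommGroup H] [InnerProductSpace ℂ H] [CompleteSpace H]

/-- The coordinate maps `Vᵢ^*` of a family of isometries `Vᵢ : K → H`. -/
def coord (V : ι → K →ₗᵢ[ℂ] H) (i : ι) : H →L[ℂ] K :=
  ContinuousLinearMap.adjoint (V i).toContinuousLinearMap

theorem inner_coord (V : ι → K →ₗᵢ[ℂ] H) (i : ι) (g : K) (u : H) :
    inner ℂ g (coord V i u) = inner ℂ (V i g) u :=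
  ContinuousLinearMap.adjoint_inner_right _ _ _

variable {V : ι → K →ₗᵢ[ℂ] H}

theorem coord_apply_self (i : ι) (f : K) : coord V i (V i f) = f :=
  ext_inner_left ℂ fun g => by rw [inner_coord, (V i).inner_map_map]

theorem coord_apply_of_ne (hV : OrthogonalFamily ℂ (fun _ => K) V) {i j : ι} (hij : i ≠ j)
    (f : K) : coord V i (V j f) = 0 :=
  ext_inner_left ℂ fun g => by rw [inner_coord, hV hij, inner_zero_right]

theorem sum_norm_sq_coord_le (hV : OrthogonalFamily ℂ (fun _ => K) V) (F : Finset ι) (u : H) :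
    ∑ i ∈ F, ‖coord V i u‖ ^ 2 ≤ ‖u‖ ^ 2 := by
  let p := ∑ i ∈ F, V i (coord V i u)
  have hp : ‖p‖ ^ 2 = ∑ i ∈ F, ‖coord V i u‖ ^ 2 := hV.norm_sum _ F
  have hinner : inner ℂ p u = ((‖p‖ ^ 2 : ℝ) : ℂ) := by
    rw [hp, sum_inner]
    push_cast
    exact Finset.sum_congr rfl fun i _ => by rw [← inner_coord, inner_self_eq_norm_sq_to_K]; rfl
  have hle : ‖p‖ * ‖p‖ ≤ ‖p‖ * ‖u‖ :=
    calc ‖p‖ * ‖p‖ = ‖inner ℂ p u‖ := by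
          rw [hinner, Complex.norm_real, Real.norm_of_nonneg (sq_nonneg _), sq]
      _ ≤ ‖p‖ * ‖u‖ := norm_inner_le_norm p u
  rw [← hp]
  rcases (norm_nonneg p).eq_or_lt with h0 | h0
  · rw [← h0, zero_pow two_ne_zero]
    positivity
  · exact pow_le_pow_left₀ h0.le (le_of_mul_le_mul_left hle h0) 2

theorem coord_comp_comp_mem_centralizer {S : Set (K →L[ℂ] K)} {T : H →L[ℂ] H} {i j : ι}
    (h : ∀ R ∈ StarSubalgebra.centralizer ℂ (StarSubalgebra.centralizer ℂ S : Set (K →L[ℂ] K)),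
      ∀ f g, inner ℂ (V i (star R g)) (T (V j f)) = inner ℂ (V i g) (T (V j (R f)))) :
    coord V i ∘L T ∘L (V j).toContinuousLinearMap ∈ StarSubalgebra.centralizer ℂ S :=
  mem_centralizer_of_form (fun f g => inner_coord V i g (T (V j f))) h

variable {M : StarSubalgebra ℂ (H →L[ℂ] H)} {N : StarSubalgebra ℂ (K →L[ℂ] K)}
  (hVM : ∀ i j, ∀ T ∈ M, coord V i ∘L T ∘L (V j).toContinuousLinearMap ∈ N)

/-- The matrix entries `Vᵢ^* T Vⱼ` of the operators of an algebra `M`, if they lie in the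
algebra `N`. -/
def entry (i j : ι) : M →L[ℂ] N where
  toFun T := ⟨coord V i ∘L (T : H →L[ℂ] H) ∘L (V j).toContinuousLinearMap, hVM i j T T.2⟩
  map_add' T T' := by ext; simp
  map_smul' c T := by ext; simp
  cont := by fun_prop

theorem inner_entry_apply (i j : ι) (T : M) (g f : K) :
    inner ℂ g ((entry hVM i j T : K →L[ℂ] K) f) = inner ℂ (V i g) ((T : H →L[ℂ] H) (V j f)) :=
  inner_coord V i g ((T : H →L[ℂ] H) (V j f))

theorem comp_entry_mem_normalFunctionals {S : Set (H →L[ℂ] H)}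
    (hM : M = StarSubalgebra.centralizer ℂ S) {ω : N →L[ℂ] ℂ} (hω : ω ∈ normalFunctionals N)
    (i j : ι) : ω ∘L entry hVM i j ∈ normalFunctionals M := by
  obtain ⟨f, g, hfg, rfl⟩ := exists_eq_tsum_vectorFunctional hω
  have hVfg : Summable fun n => ‖V j (f n)‖ * ‖V i (g n)‖ := by
    simpa only [LinearIsometry.norm_map] using hfg
  have heq : (∑' n, vectorFunctional N (g n) (f n)) ∘L entry hVM i j =
      ∑' n, vectorFunctional M (V i (g n)) (V j (f n)) :=
    ContinuousLinearMap.ext fun T =>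
      (tsum_vectorFunctional_apply N hfg _).trans <|
        (tsum_congr fun n => inner_entry_apply hVM i j T (g n) (f n)).trans
          (tsum_vectorFunctional_apply M hVfg T).symm
  rw [heq]
  exact tsum_mem_normalFunctionals hM (fun _ => vectorFunctional_mem_normalFunctionals M _ _)
    (summable_vectorFunctional M hVfg)

/-- Instance search does not find the normed structure on the values of the forms below. -/
instance {H E : Type*} [NormedAddCommGroup H] [NormedSpace ℂ H] [NormedAddCommGroup E]
    [NormedSpace ℂ E] : NormedAddCommGroup (H →L[ℂ] (E →L[ℂ] ℂ)) :=
  ContinuousLinearMap.toNormedAddCommGroup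

/-- The compression to finitely many coordinates of the matrix with entries `Φ(Vᵢ^* T Vⱼ)`, as a
form on `H` depending on `T`. -/
def compressedForm (Φ : N →L[ℂ] N) (F : Finset ι) : H →L⋆[ℂ] H →L[ℂ] (M →L[ℂ] ℂ) :=
  ∑ i ∈ F, ∑ j ∈ F,
    (ContinuousLinearMap.compL ℂ H (N →L[ℂ] ℂ) (M →L[ℂ] ℂ)
      ((ContinuousLinearMap.compL ℂ M N ℂ).flip (Φ ∘L entry hVM i j))).comp
    ((vectorFunctional N).bilinearComp (coord V i) (coord V j))

theorem compressedForm_apply (Φ : N →L[ℂ] N) (F : Finset ι) (v u : H) (T : M) :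
    compressedForm hVM Φ F v u T = ∑ i ∈ F, ∑ j ∈ F,
      inner ℂ (coord V i v) ((Φ (entry hVM i j T) : K →L[ℂ] K) (coord V j u)) := by
  simp [compressedForm]

theorem compressedForm_apply_apply (hV : OrthogonalFamily ℂ (fun _ => K) V) (Φ : N →L[ℂ] N)
    {F : Finset ι} {i j : ι} (hi : i ∈ F) (hj : j ∈ F) (g f : K) (T : M) :
    compressedForm hVM Φ F (V i g) (V j f) T =
      inner ℂ g ((Φ (entry hVM i j T) : K →L[ℂ] K) f) := by
  rw [compressedForm_apply, Finset.sum_eq_single_of_mem i hi, Finset.sum_eq_single_of_mem j hj,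
    coord_apply_self, coord_apply_self]
  · intro k _ hk
    rw [coord_apply_of_ne hV hk, map_zero, inner_zero_right]
  · intro k _ hk
    simp [coord_apply_of_ne hV hk]

variable {κ : Type*} [Fintype κ] {T : κ → κ → M} {c : ℝ}

theorem formBound_entry (hV : OrthogonalFamily ℂ (fun _ => K) V)
    (hT : FormBound (operatorForm fun k l => (T k l : H →L[ℂ] H)) c) (F : Finset ι) :
    FormBound (operatorForm fun k l : κ × F =>
      (entry hVM k.2 l.2 (T k.1 l.1) : K →L[ℂ] K)) c := by
  intro v u
  let assemble (u : PiLp 2 fun _ : κ × F => K) : PiLp 2 fun _ : κ => H :=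
    WithLp.toLp 2 fun k => ∑ i : F, V i (u (k, i))
  have hnorm (u : PiLp 2 fun _ : κ × F => K) : ‖assemble u‖ = ‖u‖ := by
    rw [PiLp.norm_eq_of_L2, PiLp.norm_eq_of_L2, Fintype.sum_prod_type]
    exact congrArg _ (Finset.sum_congr rfl fun k _ =>
      (hV.comp Subtype.val_injective).norm_sum (fun i => u (k, i)) Finset.univ)
  have hbound := hT (assemble v) (assemble u)
  rw [hnorm, hnorm] at hbound
  convert! hbound using 2
  simp only [Fintype.sum_prod_type, operatorForm, inner_entry_apply, assemble, map_sum,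
    sum_inner, inner_sum]
  refine Finset.sum_congr rfl fun k _ => ?_
  rw [Finset.sum_comm]
  exact Finset.sum_congr rfl fun l _ => Finset.sum_comm

theorem formBound_compressedForm (hV : OrthogonalFamily ℂ (fun _ => K) V) {Φ : N →L[ℂ] N} {C : ℝ}
    (hC : 0 ≤ C) (hΦ : CBBound (Φ : N →ₗ[ℂ] N) C) (hc : 0 ≤ c)
    (hT : FormBound (operatorForm fun k l => (T k l : H →L[ℂ] H)) c) (F : Finset ι) :
    FormBound (fun k l v u => compressedForm hVM Φ F v u (T k l)) (C * c) := by
  intro v u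
  let coords (u : PiLp 2 fun _ : κ => H) : PiLp 2 fun _ : κ × F => K :=
    WithLp.toLp 2 fun k => coord V k.2 (u k.1)
  have hnorm (u : PiLp 2 fun _ : κ => H) : ‖coords u‖ ≤ ‖u‖ := by
    rw [PiLp.norm_eq_of_L2, PiLp.norm_eq_of_L2, Fintype.sum_prod_type]
    refine Real.sqrt_le_sqrt (Finset.sum_le_sum fun k _ => ?_)
    exact (Finset.sum_coe_sort F fun i => ‖coord V i (u k)‖ ^ 2).trans_le
      (sum_norm_sq_coord_le hV F (u k))
  calc ‖∑ k, ∑ l, compressedForm hVM Φ F (v k) (u l) (T k l)‖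
      = ‖∑ k : κ × F, ∑ l : κ × F, operatorForm (fun k l : κ × F =>
          (Φ (entry hVM k.2 l.2 (T k.1 l.1)) : K →L[ℂ] K)) k l (coords v k) (coords u l)‖ := by
        simp only [Fintype.sum_prod_type, compressedForm_apply, operatorForm, coords,
          ← Finset.sum_coe_sort F]
        exact congrArg _ (Finset.sum_congr rfl fun k _ => Finset.sum_comm)
    _ ≤ C * c * (‖coords u‖ * ‖coords v‖) :=
        hΦ.formBound hC hc (formBound_entry hVM hV hT F) (coords v) (coords u)
    _ ≤ C * c * (‖u‖ * ‖v‖) := by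
        gcongr
        exacts [hnorm u, hnorm v]

theorem norm_compressedForm_le (hV : OrthogonalFamily ℂ (fun _ => K) V) {Φ : N →L[ℂ] N} {C : ℝ}
    (hC : 0 ≤ C) (hΦ : CBBound (Φ : N →ₗ[ℂ] N) C) (F : Finset ι) (v u : H) (T : M) :
    ‖compressedForm hVM Φ F v u T‖ ≤ C * ‖v‖ * ‖u‖ * ‖T‖ :=
  calc _ ≤ C * ‖T‖ * (‖u‖ * ‖v‖) := formBound_of_unique.1
        (formBound_compressedForm hVM hV hC hΦ (norm_nonneg _)
          (formBound_operatorForm_unit (T : H →L[ℂ] H)) F) v u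
    _ = C * ‖v‖ * ‖u‖ * ‖T‖ := by ring

theorem exists_tendsto_form {α H E : Type*} [NormedAddCommGroup H] [NormedSpace ℂ H]
    [NormedAddCommGroup E] [NormedSpace ℂ E] (𝒰 : Ultrafilter α) {C : ℝ} (hC : 0 ≤ C)
    {Θ : α → H →L⋆[ℂ] H →L[ℂ] (E →L[ℂ] ℂ)}
    (hΘ : ∀ a v u T, ‖Θ a v u T‖ ≤ C * ‖v‖ * ‖u‖ * ‖T‖) :
    ∃ Λ : H →L⋆[ℂ] H →L[ℂ] (E →L[ℂ] ℂ),
      ∀ v u T, Tendsto (fun a => Θ a v u T) 𝒰 (𝓝 (Λ v u T)) := by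
  have hlim (v u T) : ∃ L, Tendsto (fun a => Θ a v u T) 𝒰 (𝓝 L) := by
    obtain ⟨L, -, hL⟩ := (isCompact_closedBall (0 : ℂ) (C * ‖v‖ * ‖u‖ * ‖T‖)).ultrafilter_le_nhds
      (𝒰.map fun a => Θ a v u T) (le_principal_iff.2 (mem_map.2 (univ_mem' fun a => by
        simpa using hΘ a v u T)))
    exact ⟨L, hL⟩
  choose L hL using hlim
  have hunique {v u T z} (h : Tendsto (fun a => Θ a v u T) 𝒰 (𝓝 z)) : L v u T = z :=
    tendsto_nhds_unique (hL v u T) h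
  let functional (v u : H) : E →ₗ[ℂ] ℂ :=
    { toFun := L v u
      map_add' := fun T T' => hunique (by simpa using (hL v u T).add (hL v u T'))
      map_smul' := fun c T => hunique (by simpa using (hL v u T).const_mul c) }
  have hfunctional (v u T) : ‖functional v u T‖ ≤ C * ‖v‖ * ‖u‖ * ‖T‖ :=
    le_of_tendsto (hL v u T).norm (Eventually.of_forall fun a => hΘ a v u T)
  refine ⟨LinearMap.mkContinuous₂ (LinearMap.mk₂'ₛₗ (starRingEnd ℂ) (RingHom.id ℂ)
    (fun v u => (functional v u).mkContinuous _ (hfunctional v u)) ?_ ?_ ?_ ?_) C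
    fun v u => LinearMap.mkContinuous_norm_le _ (by positivity) (hfunctional v u), hL⟩
  · exact fun v v' u => ContinuousLinearMap.ext fun T =>
      hunique (by simpa [functional] using (hL v u T).add (hL v' u T))
  · exact fun c v u => ContinuousLinearMap.ext fun T =>
      hunique (by simpa [functional] using (hL v u T).const_mul (starRingEnd ℂ c))
  · exact fun v u u' => ContinuousLinearMap.ext fun T =>
      hunique (by simpa [functional] using (hL v u T).add (hL v u' T))
  · exact fun c v u => ContinuousLinearMap.ext fun T =>
      hunique (by simpa [functional] using (hL v u T).const_mul c)

/-- A form on `H` with values in the functionals on the operator algebra `M` is completely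
bounded by `C`; it stands for the map `Φ` with `⟨v, Φ(T) u⟩ = Λ v u T`. -/
def IsCBForm (Λ : H →L⋆[ℂ] H →L[ℂ] (M →L[ℂ] ℂ)) (C : ℝ) : Prop :=
  ∀ (n : ℕ) (T : Fin n → Fin n → M),
    FormBound (fun k l v u => Λ v u (T k l)) (C * ‖opMatrix fun k l => (T k l : H →L[ℂ] H)‖)

theorem exists_amplification (hV : OrthogonalFamily ℂ (fun _ => K) V) {Φ : N →ₗ[ℂ] N} {C : ℝ}
    (hC : 0 ≤ C) (hΦ : CBBound Φ C) : ∃ Λ : H →L⋆[ℂ] H →L[ℂ] (M →L[ℂ] ℂ), IsCBForm Λ C ∧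
      ∀ i j g f T, Λ (V i g) (V j f) T =
        inner ℂ g ((Φ (entry hVM i j T) : K →L[ℂ] K) f) := by
  classical
  let Φ' : N →L[ℂ] N := Φ.mkContinuous C (hΦ.norm_apply_le hC)
  have hΦ' : CBBound (Φ' : N →ₗ[ℂ] N) C := hΦ
  let 𝒰 : Ultrafilter (Finset ι) := Ultrafilter.of atTop
  have h𝒰 : (𝒰 : Filter (Finset ι)) ≤ atTop := Ultrafilter.of_le _
  obtain ⟨Λ, hΛ⟩ := exists_tendsto_form 𝒰 hC (norm_compressedForm_le hVM hV hC hΦ')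
  refine ⟨Λ, fun n T v u => ?_, fun i j g f T => ?_⟩
  · have hlim := tendsto_finsetSum Finset.univ fun k _ => tendsto_finsetSum Finset.univ fun l _ =>
      hΛ (v k) (u l) (T k l)
    exact le_of_tendsto hlim.norm (Eventually.of_forall fun F =>
      formBound_compressedForm hVM hV hC hΦ' (norm_nonneg _)
        ((norm_opMatrix_le_iff (norm_nonneg _)).1 le_rfl) F v u)
  · refine tendsto_nhds_unique (hΛ _ _ T) (tendsto_const_nhds.congr' ?_)
    filter_upwards [h𝒰 (eventually_ge_atTop {i, j})] with F hF
    exact (compressedForm_apply_apply hVM hV Φ' (hF (by simp)) (hF (by simp)) g f T).symm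

end Amplification

section Dense

variable {ι K H : Type*} [NormedAddCommGroup K] [InnerProductSpace ℂ K]
  [NormedAddCommGroup H] [InnerProductSpace ℂ H] {V : ι → K →ₗᵢ[ℂ] H}
  (hV : (⨆ i, (V i).toLinearMap.range).topologicalClosure = ⊤)

include hV

theorem mem_of_forall_range_mem {W : Submodule ℂ H} (hW : IsClosed (W : Set H))
    (h : ∀ i f, V i f ∈ W) (u : H) : u ∈ W := by
  refine Submodule.topologicalClosure_minimal _ (iSup_le fun i => ?_) hW (hV.ge Submodule.mem_top)
  rintro _ ⟨f, rfl⟩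
  exact h i f

theorem form_mem_of_forall_range_mem {E : Type*} [NormedAddCommGroup E] [NormedSpace ℂ E]
    (Λ : H →L⋆[ℂ] H →L[ℂ] E) {W : Submodule ℂ E} (hW : IsClosed (W : Set E))
    (h : ∀ i j g f, Λ (V i g) (V j f) ∈ W) (v u : H) : Λ v u ∈ W := by
  have hleft (i g) : Λ (V i g) u ∈ W :=
    mem_of_forall_range_mem hV (W := W.comap (Λ (V i g)).toLinearMap)
      (hW.preimage (Λ (V i g)).continuous) (fun j f => h i j g f) u
  exact mem_of_forall_range_mem hV (W := W.comap (Λ.flip u).toLinearMap)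
    (hW.preimage (Λ.flip u).continuous) hleft v

theorem form_ext_of_range {E : Type*} [NormedAddCommGroup E] [NormedSpace ℂ E]
    {Λ Λ' : H →L⋆[ℂ] H →L[ℂ] E} (h : ∀ i j g f, Λ (V i g) (V j f) = Λ' (V i g) (V j f)) :
    Λ = Λ' := by
  refine ContinuousLinearMap.ext fun v => ContinuousLinearMap.ext fun u => sub_eq_zero.1 ?_
  exact (Submodule.mem_bot ℂ).1 (form_mem_of_forall_range_mem hV (Λ - Λ') isClosed_singleton
    (fun i j g f => (Submodule.mem_bot ℂ).2 (sub_eq_zero.2 (h i j g f))) v u)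

theorem form_apply_eq_inner {E : Type*} [NormedAddCommGroup E] [NormedSpace ℂ E]
    (Λ : H →L⋆[ℂ] H →L[ℂ] (E →L[ℂ] ℂ)) {T : E} {A : H →L[ℂ] H}
    (h : ∀ i j g f, Λ (V i g) (V j f) T = inner ℂ (V i g) (A (V j f))) (v u : H) :
    Λ v u T = inner ℂ v (A u) := by
  let evalForm : H →L⋆[ℂ] H →L[ℂ] ℂ :=
    (ContinuousLinearMap.compL ℂ H (E →L[ℂ] ℂ) ℂ (ContinuousLinearMap.apply ℂ ℂ T)).comp Λ
  let innerForm : H →L⋆[ℂ] H →L[ℂ] ℂ :=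
    ((ContinuousLinearMap.compL ℂ H H ℂ).flip A).comp (innerSL ℂ)
  have heq : evalForm = innerForm := form_ext_of_range hV h
  exact DFunLike.congr_fun (DFunLike.congr_fun heq v) u

end Dense

theorem exists_normal_amplification {ι K H : Type*} [NormedAddCommGroup K] [InnerProductSpace ℂ K]
    [CompleteSpace K] [NormedAddCommGroup H] [InnerProductSpace ℂ H] [CompleteSpace H]
    {V : ι → K →ₗᵢ[ℂ] H} {M : StarSubalgebra ℂ (H →L[ℂ] H)} {N : StarSubalgebra ℂ (K →L[ℂ] K)}
    (hVM : ∀ i j, ∀ T ∈ M, coord V i ∘L T ∘L (V j).toContinuousLinearMap ∈ N)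
    (hV : OrthogonalFamily ℂ (fun _ => K) V)
    (hdense : (⨆ i, (V i).toLinearMap.range).topologicalClosure = ⊤)
    {S : Set (H →L[ℂ] H)} (hM : M = StarSubalgebra.centralizer ℂ S) {Φ : N →ₗ[ℂ] N} {C : ℝ}
    (hC : 0 ≤ C) (hcb : CBBound Φ C)
    (hΦ : ∀ g f, ∃ ω ∈ normalFunctionals N, ∀ T, inner ℂ g ((Φ T : K →L[ℂ] K) f) = ω T) :
    ∃ Λ : H →L⋆[ℂ] H →L[ℂ] (M →L[ℂ] ℂ), IsCBForm Λ C ∧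
      (∀ v u, Λ v u ∈ normalFunctionals M) ∧
      ∀ (T : M) (A : H →L[ℂ] H), (∀ i j g f,
        inner ℂ g ((Φ (entry hVM i j T) : K →L[ℂ] K) f) = inner ℂ (V i g) (A (V j f))) →
        ∀ v u, Λ v u T = inner ℂ v (A u) := by
  obtain ⟨Λ, hΛcb, hΛ⟩ := exists_amplification hVM hV hC hcb
  refine ⟨Λ, hΛcb, form_mem_of_forall_range_mem hdense Λ (isClosed_normalFunctionals hM)
    fun i j g f => ?_, fun T A hA => form_apply_eq_inner hdense Λ fun i j g f =>
      (hΛ i j g f T).trans (hA i j g f)⟩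
  obtain ⟨ω, hω, heq⟩ := hΦ g f
  have : Λ (V i g) (V j f) = ω ∘L entry hVM i j :=
    ContinuousLinearMap.ext fun T => (hΛ i j g f T).trans (heq _)
  rw [this]
  exact comp_entry_mem_normalFunctionals hVM hM hω i j

section NormalMap

variable {H : Type*} [NormedAddCommGroup H] [InnerProductSpace ℂ H]

theorem summable_form {E : Type*} [NormedAddCommGroup E] [NormedSpace ℂ E] [CompleteSpace E]
    (Λ : H →L⋆[ℂ] H →L[ℂ] E) {ι : Type*} {f g : ι → H}
    (h : Summable fun i => ‖f i‖ * ‖g i‖) : Summable fun i => Λ (g i) (f i) :=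
  Summable.of_norm_bounded (h.mul_left ‖Λ‖) fun i =>
    (Λ.le_opNorm₂ _ _).trans_eq (by ring)

variable [CompleteSpace H] {S : Set (H →L[ℂ] H)} {M : StarSubalgebra ℂ (H →L[ℂ] H)}
  {Λ : H →L⋆[ℂ] H →L[ℂ] (M →L[ℂ] ℂ)}

theorem exists_map_of_form (hM : M = StarSubalgebra.centralizer ℂ S)
    (hcomm : ∀ R ∈ StarSubalgebra.centralizer ℂ (M : Set (H →L[ℂ] H)),
      ∀ v u, Λ (star R v) u = Λ v (R u)) :
    ∃ Ψ : M →ₗ[ℂ] M, ∀ T v u, inner ℂ v ((Ψ T : H →L[ℂ] H) u) = Λ v u T := by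
  have hop (T : M) : ∃ A : M, ∀ v u, inner ℂ v ((A : H →L[ℂ] H) u) = Λ v u T := by
    obtain ⟨A, hA⟩ := exists_operator_of_form
      ((ContinuousLinearMap.compL ℂ H (M →L[ℂ] ℂ) ℂ (ContinuousLinearMap.apply ℂ ℂ T)).comp Λ)
    refine ⟨⟨A, ?_⟩, fun v u => hA u v⟩
    rw [hM]
    refine mem_centralizer_of_form hA fun R hR f g => ?_
    exact DFunLike.congr_fun (hcomm R (hM ▸ hR) g f) T
  choose Ψ hΨ using hop
  have hunique {A B : M}
      (h : ∀ v u, inner ℂ v ((A : H →L[ℂ] H) u) = inner ℂ v ((B : H →L[ℂ] H) u)) : A = B :=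
    Subtype.ext (ContinuousLinearMap.ext fun u => ext_inner_left ℂ fun v => h v u)
  exact ⟨{ toFun := Ψ
           map_add' := fun T T' => hunique fun v u => by simp [hΨ]
           map_smul' := fun c T => hunique fun v u => by simp [hΨ] }, hΨ⟩

variable {Ψ : M →ₗ[ℂ] M} (hΨ : ∀ T v u, inner ℂ v ((Ψ T : H →L[ℂ] H) u) = Λ v u T)

include hΨ

theorem IsCBForm.cbBound {C : ℝ} (hΛ : IsCBForm Λ C) (hC : 0 ≤ C) : CBBound Ψ C := fun n T =>
  (norm_opMatrix_le_iff (by positivity)).2 (by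
    simpa only [FormBound, operatorForm, hΨ] using hΛ n T)

theorem exists_normalFunctional_of_form (hM : M = StarSubalgebra.centralizer ℂ S)
    (hN : ∀ v u, Λ v u ∈ normalFunctionals M) {ω : M →L[ℂ] ℂ} (hω : ω ∈ normalFunctionals M) :
    ∃ ω' ∈ normalFunctionals M, ∀ T, ω (Ψ T) = ω' T := by
  obtain ⟨f, g, hfg, rfl⟩ := exists_eq_tsum_vectorFunctional hω
  have hsum : Summable fun n => Λ (g n) (f n) := summable_form Λ hfg
  refine ⟨∑' n, Λ (g n) (f n), tsum_mem_normalFunctionals hM (fun n => hN _ _) hsum, fun T => ?_⟩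
  calc (∑' n, vectorFunctional M (g n) (f n)) (Ψ T)
      = ∑' n, Λ (g n) (f n) T :=
        (tsum_vectorFunctional_apply M hfg _).trans (tsum_congr fun n => hΨ T _ _)
    _ = _ := ((ContinuousLinearMap.apply ℂ ℂ T).map_tsum hsum).symm

end NormalMap

section Averaging

theorem norm_form_isometry_le {H E : Type*} [NormedAddCommGroup H] [InnerProductSpace ℂ H]
    [NormedAddCommGroup E] [NormedSpace ℂ E] (Λ : H →L⋆[ℂ] H →L[ℂ] E) (R : H →ₗᵢ[ℂ] H)
    (v u : H) : ‖Λ (R v) (R u)‖ ≤ ‖Λ‖ * ‖v‖ * ‖u‖ :=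
  (Λ.le_opNorm₂ _ _).trans_eq (by rw [LinearIsometry.norm_map, LinearIsometry.norm_map])

variable {Z H : Type*} [TopologicalSpace Z] [SecondCountableTopology Z] [MeasurableSpace Z]
  [OpensMeasurableSpace Z] [NormedAddCommGroup H] [InnerProductSpace ℂ H]
  (P : Measure Z) [IsProbabilityMeasure P] {R : Z → H →ₗᵢ[ℂ] H}
  (hR : ∀ u, Continuous fun z => R z u)

section

variable {E : Type*} [NormedAddCommGroup E] [NormedSpace ℂ E] (Λ : H →L⋆[ℂ] H →L[ℂ] E)

include hR in
theorem integrable_form_isometry (v u : H) : Integrable (fun z => Λ (R z v) (R z u)) P :=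
  Integrable.of_bound
    ((Λ.continuous.comp (hR v)).clm_apply (hR u)).aestronglyMeasurable _
    (Eventually.of_forall fun z => norm_form_isometry_le Λ (R z) v u)

/-- The average of a form over a family of isometries. -/
def averagedForm : H →L⋆[ℂ] H →L[ℂ] E :=
  LinearMap.mkContinuous₂ (LinearMap.mk₂'ₛₗ (starRingEnd ℂ) (RingHom.id ℂ)
    (fun v u => ∫ z, Λ (R z v) (R z u) ∂P)
    (fun v v' u => by
      simp [integral_add (integrable_form_isometry P hR Λ v u)
        (integrable_form_isometry P hR Λ v' u)])
    (fun c v u => by simp [integral_smul])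
    (fun v u u' => by
      simp [integral_add (integrable_form_isometry P hR Λ v u)
        (integrable_form_isometry P hR Λ v u')])
    (fun c v u => by simp [integral_smul])) ‖Λ‖ fun v u =>
      (norm_integral_le_of_norm_le_const (Eventually.of_forall fun z =>
        norm_form_isometry_le Λ (R z) v u)).trans_eq (by simp)

theorem averagedForm_mem [CompleteSpace E] {W : Submodule ℂ E} (hW : IsClosed (W : Set E))
    (hΛ : ∀ v u, Λ v u ∈ W) (v u : H) : averagedForm P hR Λ v u ∈ W :=
  (W.restrictScalars ℝ).convex.integral_mem hW (Eventually.of_forall fun _ => hΛ _ _)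
    (integrable_form_isometry P hR Λ v u)

theorem averagedForm_apply_apply (Λ : H →L⋆[ℂ] H →L[ℂ] (E →L[ℂ] ℂ)) (v u : H) (T : E) :
    averagedForm P hR Λ v u T = ∫ z, Λ (R z v) (R z u) T ∂P :=
  ContinuousLinearMap.integral_apply (integrable_form_isometry P hR Λ v u) T

end

theorem isCBForm_averagedForm [CompleteSpace H] {M : StarSubalgebra ℂ (H →L[ℂ] H)}
    {Λ : H →L⋆[ℂ] H →L[ℂ] (M →L[ℂ] ℂ)} {C : ℝ} (hΛ : IsCBForm Λ C) :
    IsCBForm (averagedForm P hR Λ) C := by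
  intro n T v u
  have hint (k l) : Integrable (fun z => Λ (R z (v k)) (R z (u l)) (T k l)) P :=
    (ContinuousLinearMap.apply ℂ ℂ (T k l)).integrable_comp
      (integrable_form_isometry P hR Λ (v k) (u l))
  let translate (z : Z) (u : PiLp 2 fun _ : Fin n => H) : PiLp 2 fun _ : Fin n => H :=
    WithLp.toLp 2 fun k => R z (u k)
  have hnorm (z u) : ‖translate z u‖ = ‖u‖ := by
    simp only [PiLp.norm_eq_of_L2, translate, LinearIsometry.norm_map]
  have hsum : ∑ k, ∑ l, averagedForm P hR Λ (v k) (u l) (T k l) =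
      ∫ z, ∑ k, ∑ l, Λ (translate z v k) (translate z u l) (T k l) ∂P := by
    simp only [averagedForm_apply_apply]
    exact (Finset.sum_congr rfl fun k _ => (integral_finsetSum _ fun l _ => hint k l).symm).trans
      (integral_finsetSum _ fun k _ => integrable_finsetSum _ fun l _ => hint k l).symm
  rw [hsum]
  refine (norm_integral_le_of_norm_le_const (Eventually.of_forall fun z =>
    (hΛ n T (translate z v) (translate z u)).trans_eq (by rw [hnorm, hnorm]))).trans_eq ?_
  simp

include hR in
theorem exists_averaged_normal_form [CompleteSpace H] {S : Set (H →L[ℂ] H)}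
    {M : StarSubalgebra ℂ (H →L[ℂ] H)} (hM : M = StarSubalgebra.centralizer ℂ S)
    {Λ : H →L⋆[ℂ] H →L[ℂ] (M →L[ℂ] ℂ)} {C : ℝ} (hΛ : IsCBForm Λ C)
    (hN : ∀ v u, Λ v u ∈ normalFunctionals M) :
    ∃ Θ : H →L⋆[ℂ] H →L[ℂ] (M →L[ℂ] ℂ), IsCBForm Θ C ∧
      (∀ v u, Θ v u ∈ normalFunctionals M) ∧
      ∀ T v u, Θ v u T = ∫ z, Λ (R z v) (R z u) T ∂P :=
  ⟨averagedForm P hR Λ, isCBForm_averagedForm P hR hΛ,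
    averagedForm_mem P hR Λ (isClosed_normalFunctionals hM) hN,
    fun T v u => averagedForm_apply_apply P hR Λ v u T⟩

end Averaging

section BorelSection

variable {G : Type*} [Group G] [MeasurableSpace G] {Γ : Subgroup G}

/-- A Borel cross section of the quotient map `G → G ⧸ Γ`. -/
structure BorelSection (Γ : Subgroup G) where
  toFun : G ⧸ Γ → G
  measurable : Measurable toFun
  mk_toFun : ∀ q, (QuotientGroup.mk (toFun q) : G ⧸ Γ) = q

namespace BorelSection

instance : CoeFun (BorelSection Γ) fun _ => G ⧸ Γ → G := ⟨toFun⟩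

variable (s : BorelSection Γ)

/-- The fundamental domain `Ω` given by a Borel section. -/
def domain : Set G := Set.range s

/-- The `Γ`-component of `y` in the decomposition `G = ΩΓ`. -/
def latticePart (y : G) : Γ :=
  ⟨(s (QuotientGroup.mk y))⁻¹ * y, QuotientGroup.eq.1 (s.mk_toFun _)⟩

/-- The cocycle `G × G ⧸ Γ → Γ` of the section, determined by `x s(q) = s(x q) α(x, q)`. -/
def cocycle (x : G) (q : G ⧸ Γ) : Γ := s.latticePart (x * s q)

theorem mul_latticePart (y : G) : s (QuotientGroup.mk y) * (s.latticePart y : G) = y :=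
  mul_inv_cancel_left _ _

theorem latticePart_mul_coe (y : G) (γ : Γ) : s.latticePart (y * γ) = s.latticePart y * γ := by
  ext
  simp [latticePart, QuotientGroup.mk_mul_of_mem, mul_assoc]

theorem latticePart_toFun (q : G ⧸ Γ) : s.latticePart (s q) = 1 := by
  ext
  simp [latticePart, s.mk_toFun]

theorem mk_toFun_mul_coe (q : G ⧸ Γ) (γ : Γ) : (QuotientGroup.mk (s q * γ) : G ⧸ Γ) = q := by
  rw [QuotientGroup.mk_mul_of_mem _ γ.2, s.mk_toFun]

theorem latticePart_toFun_mul_coe (q : G ⧸ Γ) (γ : Γ) : s.latticePart (s q * γ) = γ := by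
  rw [latticePart_mul_coe, latticePart_toFun, one_mul]

theorem mem_domain_iff (y : G) : y ∈ s.domain ↔ s.latticePart y = 1 := by
  constructor
  · rintro ⟨q, rfl⟩
    exact s.latticePart_toFun q
  · intro h
    exact ⟨QuotientGroup.mk y, by simpa [h] using s.mul_latticePart y⟩

theorem mk_mul_toFun (x : G) (q : G ⧸ Γ) : (QuotientGroup.mk (x * s q) : G ⧸ Γ) = x • q := by
  conv_rhs => rw [← s.mk_toFun q]
  rfl

theorem mul_toFun (x : G) (q : G ⧸ Γ) : x * s q = s (x • q) * (s.cocycle x q : G) := by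
  rw [← mk_mul_toFun, cocycle, mul_latticePart]

theorem latticePart_mul (x y : G) :
    s.latticePart (x * y) = s.cocycle x (QuotientGroup.mk y) * s.latticePart y := by
  rw [cocycle, ← latticePart_mul_coe, mul_assoc, mul_latticePart]

theorem cocycle_inv_smul (x : G) (q : G ⧸ Γ) : s.cocycle x⁻¹ (x • q) = (s.cocycle x q)⁻¹ := by
  have h : x⁻¹ * s (x • q) = s q * ((s.cocycle x q)⁻¹ : Γ) := by
    rw [InvMemClass.coe_inv, eq_mul_inv_iff_mul_eq, mul_assoc, ← mul_toFun, inv_mul_cancel_left]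
  rw [cocycle, h, latticePart_toFun_mul_coe]

theorem convCount_chi_domain (φ : Γ → ℂ) (y : G) :
    convCount Γ (chi s.domain) φ y = φ (s.latticePart y) := by
  have hmem (γ : Γ) : y * (γ : G)⁻¹ ∈ s.domain ↔ s.latticePart y = γ := by
    rw [s.mem_domain_iff, ← InvMemClass.coe_inv, s.latticePart_mul_coe, mul_inv_eq_one]
  rw [convCount, tsum_eq_single (s.latticePart y)]
  · rw [chi, Set.indicator_of_mem ((hmem _).2 rfl), Pi.one_apply, one_mul]
  · intro γ hγ
    rw [chi, Set.indicator_of_notMem (mt (hmem γ).1 hγ.symm), zero_mul]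

variable [MeasurableMul₂ G] [MeasurableInv G]

theorem measurable_latticePart : Measurable s.latticePart :=
  (((s.measurable.comp QuotientGroup.measurable_coe).inv).mul measurable_id).subtype_mk

theorem measurable_cocycle (x : G) : Measurable (s.cocycle x) :=
  s.measurable_latticePart.comp (s.measurable.const_mul x)

theorem measurableSet_domain [MeasurableSingletonClass Γ] : MeasurableSet s.domain := by
  rw [show s.domain = s.latticePart ⁻¹' {1} from Set.ext s.mem_domain_iff]
  exact s.measurable_latticePart (measurableSet_singleton 1)

/-- The measurable isomorphism `G ≃ G ⧸ Γ × Γ` given by a Borel section. -/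
def equiv : G ≃ᵐ (G ⧸ Γ) × Γ where
  toFun y := (QuotientGroup.mk y, s.latticePart y)
  invFun p := s p.1 * p.2
  left_inv y := s.mul_latticePart y
  right_inv p := Prod.ext (s.mk_toFun_mul_coe p.1 p.2) (s.latticePart_toFun_mul_coe p.1 p.2)
  measurable_toFun := QuotientGroup.measurable_coe.prodMk s.measurable_latticePart
  measurable_invFun :=
    (s.measurable.comp measurable_fst).mul (measurable_subtype_coe.comp measurable_snd)

theorem equiv_apply (y : G) : s.equiv y = (QuotientGroup.mk y, s.latticePart y) := rfl

theorem equiv_symm_apply (p : (G ⧸ Γ) × Γ) : s.equiv.symm p = s p.1 * p.2 := rfl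

theorem equiv_symm_smul (x : G) (p : (G ⧸ Γ) × Γ) :
    s.equiv.symm (x • p.1, s.cocycle x p.1 * p.2) = x * s.equiv.symm p := by
  rw [equiv_symm_apply, equiv_symm_apply, Subgroup.coe_mul, ← mul_assoc, ← mul_assoc, mul_toFun]

end BorelSection

instance [MeasurableMul G] : MeasurableConstSMul G (G ⧸ Γ) where
  measurable_const_smul x := measurable_from_quotient.2
    (QuotientGroup.measurable_coe.comp (measurable_const_mul x))

/-- A `G`-invariant probability measure `ν` on `G ⧸ Γ` which is the quotient of `μ`: the
isomorphism `G ≃ G ⧸ Γ × Γ` carries `μ` to the product of `ν` and the counting measure. -/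
structure IsQuotientMeasure [MeasurableMul₂ G] [MeasurableInv G] (s : BorelSection Γ)
    (μ : Measure G) (ν : Measure (G ⧸ Γ)) : Prop where
  isProbabilityMeasure : IsProbabilityMeasure ν
  smulInvariantMeasure : SMulInvariantMeasure G (G ⧸ Γ) ν
  measurePreserving : MeasurePreserving s.equiv μ (ν.prod Measure.count)

end BorelSection

section QuotientMeasure

variable {G : Type*} [Group G] [MeasurableSpace G] [MeasurableMul₂ G] [MeasurableInv G]
  {Γ : Subgroup G} [Countable Γ] [MeasurableSingletonClass Γ]

theorem BorelSection.measurePreserving_skew (s : BorelSection Γ) (ν : Measure (G ⧸ Γ))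
    [SFinite ν] [SMulInvariantMeasure G (G ⧸ Γ) ν] (x : G) :
    MeasurePreserving (fun p : (G ⧸ Γ) × Γ => (x • p.1, s.cocycle x p.1 * p.2))
      (ν.prod Measure.count) (ν.prod Measure.count) :=
  (measurePreserving_smul x ν).skew_product
    (g := fun q γ => s.cocycle x q * γ)
    (((s.measurable_cocycle x).comp measurable_fst).mul measurable_snd)
    (Eventually.of_forall fun _ => (measurePreserving_mul_left _ _).map_eq)

theorem BorelSection.isMulLeftInvariant_map_equiv_symm (s : BorelSection Γ) (ν : Measure (G ⧸ Γ))
    [SFinite ν] [SMulInvariantMeasure G (G ⧸ Γ) ν] :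
    ((ν.prod (Measure.count : Measure Γ)).map s.equiv.symm).IsMulLeftInvariant where
  map_mul_left_eq_self x := by
    have hcomm : (x * ·) ∘ s.equiv.symm =
        s.equiv.symm ∘ fun p : (G ⧸ Γ) × Γ => (x • p.1, s.cocycle x p.1 * p.2) :=
      funext fun p => (s.equiv_symm_smul x p).symm
    rw [Measure.map_map (measurable_const_mul x) s.equiv.symm.measurable, hcomm,
      ← Measure.map_map s.equiv.symm.measurable (s.measurePreserving_skew ν x).measurable,
      (s.measurePreserving_skew ν x).map_eq]

theorem BorelSection.map_equiv_symm_domain (s : BorelSection Γ) (ν : Measure (G ⧸ Γ)) [SFinite ν] :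
    (ν.prod Measure.count).map s.equiv.symm s.domain = ν Set.univ := by
  have hdomain : s.equiv.symm ⁻¹' s.domain = Set.univ ×ˢ {1} := by
    ext p
    simp [s.mem_domain_iff, s.equiv_symm_apply, s.latticePart_toFun_mul_coe]
  rw [MeasurableEquiv.map_apply, hdomain, Measure.prod_prod, Measure.count_singleton, mul_one]

namespace IsQuotientMeasure

variable {s : BorelSection Γ} {μ : Measure G} {ν : Measure (G ⧸ Γ)}

theorem measurePreserving_mul_coe (h : IsQuotientMeasure s μ ν) (γ : Γ) :
    MeasurePreserving (fun y : G => y * γ) μ μ := by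
  have := h.isProbabilityMeasure
  have hprod : MeasurePreserving (Prod.map id fun δ : Γ => δ * γ) (ν.prod Measure.count)
      (ν.prod Measure.count) :=
    (MeasurePreserving.id ν).prod (measurePreserving_mul_right _ γ)
  convert! (h.measurePreserving.symm.comp hprod).comp h.measurePreserving using 1
  funext y
  simp [s.equiv_apply, s.equiv_symm_apply, ← mul_assoc, s.mul_latticePart]

theorem measurePreserving_slice (h : IsQuotientMeasure s μ ν) (γ : Γ) :
    MeasurePreserving (fun q => s q * (γ : G)) ν (μ.restrict (s.latticePart ⁻¹' {γ})) := by
  have := h.isProbabilityMeasure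
  have hm : Measurable fun q => s q * (γ : G) := s.measurable.mul_const _
  refine ⟨hm, Measure.ext fun A hA => ?_⟩
  have hpre : A ∩ s.latticePart ⁻¹' {γ} =
      s.equiv ⁻¹' (((fun q => s q * (γ : G)) ⁻¹' A) ×ˢ {γ}) := by
    ext y
    simp only [Set.mem_inter_iff, Set.mem_preimage, Set.mem_singleton_iff, s.equiv_apply,
      Set.mem_prod]
    refine and_congr_left ?_
    rintro rfl
    rw [s.mul_latticePart]
  rw [Measure.map_apply hm hA, Measure.restrict_apply hA, hpre,
    h.measurePreserving.measure_preimage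
      ((hm hA).prod (measurableSet_singleton γ)).nullMeasurableSet,
    Measure.prod_prod, Measure.count_singleton, mul_one]

theorem measurePreserving_mk (h : IsQuotientMeasure s μ ν) :
    MeasurePreserving (QuotientGroup.mk : G → G ⧸ Γ) (μ.restrict s.domain) ν := by
  have hslice := h.measurePreserving_slice 1
  rw [show s.latticePart ⁻¹' {1} = s.domain from (Set.ext s.mem_domain_iff).symm] at hslice
  refine ⟨QuotientGroup.measurable_coe, ?_⟩
  rw [← hslice.map_eq, Measure.map_map QuotientGroup.measurable_coe hslice.measurable]
  simp [Function.comp_def, s.mk_toFun]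

theorem hat_eq_integral [μ.IsMulLeftInvariant] (h : IsQuotientMeasure s μ ν) (φ : Γ → ℂ) (x : G) :
    hat μ Γ s.domain φ x = ∫ q, φ (s.cocycle x q) ∂ν := by
  have htilde (y : G) : tilde (chi s.domain) (y⁻¹ * x) = s.domain.indicator 1 (x⁻¹ * y) := by
    by_cases hy : x⁻¹ * y ∈ s.domain <;> simp [tilde, chi, hy]
  calc hat μ Γ s.domain φ x
      = ∫ y, φ (s.latticePart y) * s.domain.indicator 1 (x⁻¹ * y) ∂μ := by
        simp only [hat, conv, s.convCount_chi_domain, htilde]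
    _ = ∫ y, φ (s.latticePart (x * y)) * s.domain.indicator 1 y ∂μ := by
        rw [← integral_mul_left_eq_self _ x]
        simp only [inv_mul_cancel_left]
    _ = ∫ y in s.domain, φ (s.cocycle x (QuotientGroup.mk y)) ∂μ := by
        rw [← integral_indicator s.measurableSet_domain]
        refine integral_congr_ae (Eventually.of_forall fun y => ?_)
        by_cases hy : y ∈ s.domain
        · simp [hy, s.latticePart_mul, (s.mem_domain_iff y).1 hy]
        · simp [hy]
    _ = ∫ q, φ (s.cocycle x q) ∂ν := by
        rw [← h.measurePreserving_mk.map_eq,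
          integral_map QuotientGroup.measurable_coe.aemeasurable]
        exact ((measurable_of_countable φ).comp (s.measurable_cocycle x)).aestronglyMeasurable

/-- The weight `q ↦ φ(α(x⁻¹, q)⁻¹)`, by which a multiplier of `Γ` acts on `λ(x)`, has mean
`φ̂(x)`. -/
theorem integral_cocycle_inv [μ.IsMulLeftInvariant] (h : IsQuotientMeasure s μ ν) (φ : Γ → ℂ)
    (x : G) : ∫ q, φ (s.cocycle x⁻¹ q)⁻¹ ∂ν = hat μ Γ s.domain φ x := by
  have := h.smulInvariantMeasure
  rw [h.hat_eq_integral, ← (measurePreserving_smul x ν).integral_comp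
    (MeasurableEquiv.smul x).measurableEmbedding]
  simp only [s.cocycle_inv_smul, inv_inv]

end IsQuotientMeasure

end QuotientMeasure

section Unimodular

/-- Poincaré recurrence: an orbit on which `F` grows geometrically is not recurrent. -/
theorem le_one_of_comp_eq_mul {X : Type*} [MeasurableSpace X] {ν : Measure X} [IsFiniteMeasure ν]
    [NeZero ν] {T : X → X} (hT : MeasurePreserving T ν ν) {F : X → ℝ} (hF : Measurable F)
    (hpos : ∀ q, 0 < F q) {c : ℝ} (hc : ∀ q, F (T q) = c * F q) : c ≤ 1 := by
  by_contra! hc1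
  have hiterate (n : ℕ) (q : X) : F (T^[n] q) = c ^ n * F q := by
    induction n with
    | zero => simp
    | succ n ih => rw [Function.iterate_succ_apply', hc, ih, pow_succ']; ring
  have hrecurrent : ∀ᵐ q ∂ν, ∀ k : ℕ, F q ≤ k → ∃ᶠ n in atTop, F (T^[n] q) ≤ k :=
    ae_all_iff.2 fun k => hT.conservative.ae_mem_imp_frequently_image_mem
      (hF measurableSet_Iic).nullMeasurableSet
  obtain ⟨q, hq⟩ := hrecurrent.exists
  obtain ⟨k, hk⟩ := exists_nat_ge (F q)
  have hlim : Tendsto (fun n => F (T^[n] q)) atTop atTop := by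
    simpa only [hiterate] using (tendsto_pow_atTop_atTop_of_one_lt hc1).atTop_mul_const (hpos q)
  exact hq k hk ((hlim.eventually_gt_atTop (k : ℝ)).mono fun n => not_le.2)

variable {G : Type*} [Group G] [TopologicalSpace G] [IsTopologicalGroup G]
  [LocallyCompactSpace G] [SecondCountableTopology G] [MeasurableSpace G] [BorelSpace G]

theorem map_mul_right_eq_modularCharacter_smul (μ : Measure G) [μ.IsHaarMeasure] (g : G) :
    μ.map (· * g) = Measure.modularCharacter g • μ :=
  Measure.map_right_mul_eq_modularCharacterFun_smul μ g

theorem modularCharacter_eq_measure_preimage (μ : Measure G) [μ.IsHaarMeasure] {A : Set G}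
    (hA : MeasurableSet A) (hμA : μ A = 1) (g : G) :
    (Measure.modularCharacter g : ℝ≥0∞) = μ ((· * g) ⁻¹' A) := by
  rw [← Measure.map_apply (measurable_mul_const g) hA, map_mul_right_eq_modularCharacter_smul,
    Measure.smul_apply, hμA, ENNReal.smul_def, smul_eq_mul, mul_one]

variable {Γ : Subgroup G} {s : BorelSection Γ} {μ : Measure G} [μ.IsHaarMeasure]
  {ν : Measure (G ⧸ Γ)}

theorem BorelSection.measurable_modularCharacter [MeasurableSingletonClass Γ]
    (hμ : μ s.domain = 1) : Measurable (Measure.modularCharacter : G → NNReal) := by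
  rw [← measurable_coe_nnreal_ennreal_iff]
  simp_rw [modularCharacter_eq_measure_preimage μ s.measurableSet_domain hμ]
  exact measurable_measure_prodMk_left ((measurable_snd.mul measurable_fst) s.measurableSet_domain)

namespace IsQuotientMeasure

variable [Countable Γ] [MeasurableSingletonClass Γ]

theorem modularCharacter_coe (h : IsQuotientMeasure s μ ν) (hμ : μ s.domain = 1) (γ : Γ) :
    Measure.modularCharacter (γ : G) = 1 := by
  have hγ := modularCharacter_eq_measure_preimage μ s.measurableSet_domain hμ (γ : G)
  rw [(h.measurePreserving_mul_coe γ).measure_preimage s.measurableSet_domain.nullMeasurableSet,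
    hμ] at hγ
  exact_mod_cast hγ

theorem modularCharacter_le_one (h : IsQuotientMeasure s μ ν) (hμ : μ s.domain = 1) (x : G) :
    Measure.modularCharacter x ≤ 1 := by
  have := h.isProbabilityMeasure
  have := h.smulInvariantMeasure
  have hdescend (q : G ⧸ Γ) : Measure.modularCharacter (s (x • q)) =
      Measure.modularCharacter x * Measure.modularCharacter (s q) := by
    rw [← map_mul, s.mul_toFun, map_mul, h.modularCharacter_coe hμ, mul_one]
  exact_mod_cast le_one_of_comp_eq_mul (measurePreserving_smul x ν)
    (F := fun q => Measure.modularCharacter (s q)) (c := Measure.modularCharacter x)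
    ((s.measurable_modularCharacter hμ).comp s.measurable).coe_nnreal_real
    (fun q => NNReal.coe_pos.2 (Measure.modularCharacterFun_pos _))
    (fun q => by rw [hdescend, NNReal.coe_mul])

theorem isMulRightInvariant (h : IsQuotientMeasure s μ ν) (hμ : μ s.domain = 1) :
    μ.IsMulRightInvariant where
  map_mul_right_eq_self x := by
    have hinv : Measure.modularCharacter x * Measure.modularCharacter x⁻¹ = 1 := by
      rw [← map_mul, mul_inv_cancel, map_one]
    have hx : Measure.modularCharacter x = 1 := (h.modularCharacter_le_one hμ x).antisymm
      (hinv.symm.trans_le (mul_le_of_le_one_right' (h.modularCharacter_le_one hμ x⁻¹)))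
    rw [map_mul_right_eq_modularCharacter_smul, hx, one_smul]

end IsQuotientMeasure

theorem exists_isQuotientMeasure [T2Space G] (hΓ : IsLattice Γ) (s : BorelSection Γ)
    (hμ : μ s.domain = 1) : ∃ ν : Measure (G ⧸ Γ), IsQuotientMeasure s μ ν := by
  have := hΓ.discrete
  have : Countable Γ := countable_of_Lindelof_of_discrete
  obtain ⟨ν, _, hne, _⟩ := hΓ.exists_invariant
  let μ' : Measure G := (ν.prod Measure.count).map s.equiv.symm
  have : SigmaFinite μ' := s.equiv.symm.sigmaFinite_map
  have : μ'.IsMulLeftInvariant := s.isMulLeftInvariant_map_equiv_symm ν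
  have hμ' : μ' = ν Set.univ • μ := by
    simpa [μ', s.map_equiv_symm_domain, hμ] using
      measure_eq_div_smul μ' μ (s := s.domain) (by simp [hμ]) (by simp [hμ])
  have hcancel : (ν Set.univ)⁻¹ * ν Set.univ = 1 :=
    ENNReal.inv_mul_cancel (by simpa using hne) (measure_ne_top _ _)
  refine ⟨(ν Set.univ)⁻¹ • ν, ⟨by simpa using hcancel⟩, inferInstance, s.equiv.measurable, ?_⟩
  calc μ.map s.equiv = ((ν Set.univ)⁻¹ • μ').map s.equiv := by
        rw [hμ', smul_smul, hcancel, one_smul]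
    _ = ((ν Set.univ)⁻¹ • ν).prod Measure.count := by
        rw [Measure.map_smul, Measure.prod_smul_left,
          Measure.map_map s.equiv.measurable s.equiv.symm.measurable]
        simp

end Unimodular

section Tensor

variable {X Y : Type*} [MeasurableSpace X] [MeasurableSpace Y] {ν : Measure X} {ρ : Measure Y}

section MulOp

variable {w : X → ℂ} {C : ℝ} (hw : Measurable w) (hC : ∀ x, ‖w x‖ ≤ C)

/-- Multiplication by a bounded measurable function, as an operator on `L²`. -/
def mulOp : L2 ν →L[ℂ] L2 ν :=
  (ContinuousLinearMap.lsmul ℂ ℂ).holderL ν ∞ 2 2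
    ((memLp_top_of_bound hw.aestronglyMeasurable C (Eventually.of_forall hC)).toLp w)

theorem coeFn_mulOp (f : L2 ν) : mulOp hw hC f =ᵐ[ν] fun x => w x * f x := by
  have hwL := memLp_top_of_bound (μ := ν) hw.aestronglyMeasurable C (Eventually.of_forall hC)
  filter_upwards [(ContinuousLinearMap.lsmul ℂ ℂ).coeFn_holder (r := 2) (hwL.toLp w) f,
    hwL.coeFn_toLp] with x hx hwx
  exact hx.trans (by rw [hwx]; rfl)

theorem inner_mulOp (f g : L2 ν) :
    inner ℂ g (mulOp hw hC f) = ∫ x, w x * inner ℂ (g x) (f x) ∂ν := by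
  rw [L2.inner_def]
  refine integral_congr_ae ?_
  filter_upwards [coeFn_mulOp hw hC f] with x hx
  rw [hx]
  simp only [RCLike.inner_apply]
  ring

include hw hC in
theorem integrable_mul_inner (f g : L2 ν) :
    Integrable (fun x => w x * inner ℂ (g x) (f x)) ν :=
  (L2.integrable_inner g f).bdd_mul hw.aestronglyMeasurable (Eventually.of_forall hC)

end MulOp

theorem memLp_mul_prod (e : L2 ν) (f : L2 ρ) :
    MemLp (fun p : X × Y => e p.1 * f p.2) 2 (ν.prod ρ) := by
  have hm : AEStronglyMeasurable (fun p : X × Y => e p.1 * f p.2) (ν.prod ρ) :=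
    (Lp.memLp e).1.comp_fst.mul (Lp.memLp f).1.comp_snd
  rw [memLp_two_iff_integrable_sq_norm hm]
  simp only [norm_mul, mul_pow]
  exact ((memLp_two_iff_integrable_sq_norm (Lp.memLp e).1).1 (Lp.memLp e)).mul_prod
    ((memLp_two_iff_integrable_sq_norm (Lp.memLp f).1).1 (Lp.memLp f))

/-- The elementary tensor `e ⊗ f : (x, y) ↦ e(x) f(y)` in `L²(ν.prod ρ)`. -/
def elementaryTensor (e : L2 ν) (f : L2 ρ) : L2 (ν.prod ρ) := (memLp_mul_prod e f).toLp _

theorem coeFn_elementaryTensor (e : L2 ν) (f : L2 ρ) :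
    elementaryTensor e f =ᵐ[ν.prod ρ] fun p => e p.1 * f p.2 := MemLp.coeFn_toLp _

theorem eq_elementaryTensor {u : L2 (ν.prod ρ)} {e : L2 ν} {f : L2 ρ}
    (h : ∀ᵐ p ∂ν.prod ρ, u p = e p.1 * f p.2) : u = elementaryTensor e f :=
  Lp.ext (EventuallyEq.trans h (coeFn_elementaryTensor e f).symm)

variable [SFinite ν] [SFinite ρ]

theorem inner_elementaryTensor (e e' : L2 ν) (f f' : L2 ρ) :
    inner ℂ (elementaryTensor e f) (elementaryTensor e' f') = inner ℂ e e' * inner ℂ f f' := by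
  rw [L2.inner_def, L2.inner_def, L2.inner_def, ← integral_prod_mul]
  refine integral_congr_ae ?_
  filter_upwards [coeFn_elementaryTensor e f, coeFn_elementaryTensor e' f'] with p h h'
  rw [h, h']
  simp only [RCLike.inner_apply, map_mul]
  ring

theorem norm_elementaryTensor (e : L2 ν) (f : L2 ρ) : ‖elementaryTensor e f‖ = ‖e‖ * ‖f‖ := by
  refine (sq_eq_sq₀ (norm_nonneg _) (by positivity)).1 ?_
  have h := inner_elementaryTensor e e f f
  simp only [inner_self_eq_norm_sq_to_K] at h
  rw [mul_pow]
  exact_mod_cast h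

/-- The bilinear map `(e, f) ↦ e ⊗ f`. -/
def tensor : L2 ν →L[ℂ] L2 ρ →L[ℂ] L2 (ν.prod ρ) :=
  LinearMap.mkContinuous₂
    (LinearMap.mk₂ ℂ elementaryTensor
      (fun e e' f => (eq_elementaryTensor <| by
        filter_upwards [Lp.coeFn_add (elementaryTensor e f) (elementaryTensor e' f),
          coeFn_elementaryTensor e f, coeFn_elementaryTensor e' f,
          Measure.quasiMeasurePreserving_fst.ae (Lp.coeFn_add e e')] with p h h₁ h₂ he
        simp only [h, Pi.add_apply, h₁, h₂, he, add_mul]).symm)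
      (fun c e f => (eq_elementaryTensor <| by
        filter_upwards [Lp.coeFn_smul c (elementaryTensor e f), coeFn_elementaryTensor e f,
          Measure.quasiMeasurePreserving_fst.ae (Lp.coeFn_smul c e)] with p h h₁ he
        simp only [h, Pi.smul_apply, h₁, he, smul_mul_assoc]).symm)
      (fun e f f' => (eq_elementaryTensor <| by
        filter_upwards [Lp.coeFn_add (elementaryTensor e f) (elementaryTensor e f'),
          coeFn_elementaryTensor e f, coeFn_elementaryTensor e f',
          Measure.quasiMeasurePreserving_snd.ae (Lp.coeFn_add f f')] with p h h₁ h₂ hf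
        simp only [h, Pi.add_apply, h₁, h₂, hf, mul_add]).symm)
      (fun c e f => (eq_elementaryTensor <| by
        filter_upwards [Lp.coeFn_smul c (elementaryTensor e f), coeFn_elementaryTensor e f,
          Measure.quasiMeasurePreserving_snd.ae (Lp.coeFn_smul c f)] with p h h₁ hf
        simp only [h, Pi.smul_apply, h₁, hf, mul_smul_comm]).symm))
    1 (fun e f => by rw [LinearMap.mk₂_apply, norm_elementaryTensor, one_mul])

end Tensor

section FundamentalDomain

variable {G : Type*} [Group G] [MeasurableSpace G] [MeasurableMul₂ G] [MeasurableInv G]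
  {Γ : Subgroup G} [Countable Γ] {s : BorelSection Γ} {μ : Measure G} {ν : Measure (G ⧸ Γ)}
  (h : IsQuotientMeasure s μ ν)

namespace IsQuotientMeasure

/-- The vector `s(q) γ ↦ e(q) f(γ)` of `L²(G)`, which corresponds to `e ⊗ f` under the isomorphism
`L²(G) ≃ L²(G ⧸ Γ) ⊗ ℓ²(Γ)`. -/
def lift : L2 ν →L[ℂ] L2 (Measure.count : Measure Γ) →L[ℂ] L2 μ :=
  haveI := h.isProbabilityMeasure
  (ContinuousLinearMap.compL ℂ _ _ _ (Lp.compMeasurePreservingₗᵢ ℂ s.equiv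
    h.measurePreserving).toContinuousLinearMap) ∘L tensor

theorem inner_lift (e e' : L2 ν) (f f' : L2 (Measure.count : Measure Γ)) :
    inner ℂ (h.lift e f) (h.lift e' f') = inner ℂ e e' * inner ℂ f f' := by
  have := h.isProbabilityMeasure
  exact ((Lp.compMeasurePreservingₗᵢ (E := ℂ) (p := 2) ℂ s.equiv
    h.measurePreserving).inner_map_map _ _).trans (inner_elementaryTensor e e' f f')

theorem norm_lift (e : L2 ν) (f : L2 (Measure.count : Measure Γ)) :
    ‖h.lift e f‖ = ‖e‖ * ‖f‖ := by
  have := h.isProbabilityMeasure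
  exact ((Lp.compMeasurePreservingₗᵢ (E := ℂ) (p := 2) ℂ s.equiv
    h.measurePreserving).norm_map _).trans (norm_elementaryTensor e f)

theorem coeFn_lift (e : L2 ν) (f : L2 (Measure.count : Measure Γ)) :
    h.lift e f =ᵐ[μ] fun y => e (QuotientGroup.mk y) * f (s.latticePart y) := by
  have := h.isProbabilityMeasure
  exact (Lp.coeFn_compMeasurePreserving (elementaryTensor e f) h.measurePreserving).trans
    (h.measurePreserving.quasiMeasurePreserving.ae_eq_comp (coeFn_elementaryTensor e f))

/-- The isometries `f ↦ bᵢ ⊗ f` of `ℓ²(Γ)` into `L²(G)`, for an orthonormal basis `b`. -/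
def liftBasis {ι : Type*} (b : HilbertBasis ι ℂ (L2 ν)) (i : ι) :
    L2 (Measure.count : Measure Γ) →ₗᵢ[ℂ] L2 μ where
  toLinearMap := (h.lift (b i)).toLinearMap
  norm_map' f := (h.norm_lift (b i) f).trans (by rw [b.orthonormal.1 i, one_mul])

theorem liftBasis_apply {ι : Type*} (b : HilbertBasis ι ℂ (L2 ν)) (i : ι)
    (f : L2 (Measure.count : Measure Γ)) : h.liftBasis b i f = h.lift (b i) f := rfl

theorem orthogonalFamily_liftBasis {ι : Type*} (b : HilbertBasis ι ℂ (L2 ν)) :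
    OrthogonalFamily ℂ (fun _ => L2 (Measure.count : Measure Γ)) (h.liftBasis b) :=
  fun i j hij f g => by
    rw [liftBasis_apply, liftBasis_apply, inner_lift, b.orthonormal.2 hij, zero_mul]

include h in
theorem integral_eq {F : G → ℂ} (hF : Integrable F μ) :
    ∫ y, F y ∂μ = ∫ q, ∫ γ : Γ, F (s q * γ) ∂Measure.count ∂ν := by
  have := h.isProbabilityMeasure
  have hsymm := h.measurePreserving.symm
  have hF' : Integrable (fun p => F (s.equiv.symm p)) (ν.prod Measure.count) :=
    (hsymm.integrable_comp_emb s.equiv.symm.measurableEmbedding).2 hF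
  rw [← hsymm.integral_comp s.equiv.symm.measurableEmbedding F, integral_prod _ hF']
  rfl

variable [MeasurableSingletonClass Γ]

/-- Under `L²(G) ≃ L²(G ⧸ Γ) ⊗ ℓ²(Γ)`, `λ(x)` is the translation by `x` on `G ⧸ Γ`, twisted by
`λ` of the cocycle of the section. -/
theorem integral_mul_inner_leftReg_lift [μ.IsMulLeftInvariant] {w : G ⧸ Γ → ℂ} {C : ℝ}
    (hw : Measurable w) (hC : ∀ q, ‖w q‖ ≤ C) (x : G) (e e' : L2 ν)
    (f f' : L2 (Measure.count : Measure Γ)) :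
    ∫ y, w (QuotientGroup.mk y) * inner ℂ (h.lift e' f' y) (leftReg μ x (h.lift e f) y) ∂μ =
      ∫ q, w q * inner ℂ (e' q) (e (x⁻¹ • q)) *
        inner ℂ f' (leftReg Measure.count (s.cocycle x⁻¹ q)⁻¹ f) ∂ν := by
  have hint := integrable_mul_inner (ν := μ) (hw.comp (QuotientGroup.measurable_coe (S := Γ)))
    (fun y => hC (QuotientGroup.mk y)) (leftReg μ x (h.lift e f)) (h.lift e' f')
  let F : G → ℂ := fun y => w (QuotientGroup.mk y) *
    inner ℂ (e' (QuotientGroup.mk y) * f' (s.latticePart y))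
      (e (x⁻¹ • (QuotientGroup.mk y : G ⧸ Γ)) * f (s.latticePart (x⁻¹ * y)))
  have hae : (fun y => w (QuotientGroup.mk y) *
      inner ℂ (h.lift e' f' y) (leftReg μ x (h.lift e f) y)) =ᵐ[μ] F := by
    filter_upwards [h.coeFn_lift e' f', coeFn_leftReg μ x (h.lift e f),
      (measurePreserving_mul_left μ x⁻¹).quasiMeasurePreserving.ae (h.coeFn_lift e f)]
      with y h₁ h₂ h₃
    rw [h₁, h₂, h₃]
    rfl
  rw [integral_congr_ae hae, h.integral_eq (hint.congr hae)]
  refine integral_congr_ae (Eventually.of_forall fun q => ?_)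
  simp only [F, s.mk_toFun_mul_coe, s.latticePart_toFun_mul_coe]
  rw [L2.inner_def, ← integral_const_mul]
  refine integral_congr_ae ?_
  filter_upwards [coeFn_leftReg Measure.count (s.cocycle x⁻¹ q)⁻¹ f] with γ hγ
  rw [hγ, inv_inv, s.latticePart_mul, s.mk_toFun_mul_coe, s.latticePart_toFun_mul_coe]
  simp only [RCLike.inner_apply, map_mul]
  ring

theorem inner_leftReg_lift [μ.IsMulLeftInvariant] (x : G) (e e' : L2 ν)
    (f f' : L2 (Measure.count : Measure Γ)) :
    inner ℂ (h.lift e' f') (leftReg μ x (h.lift e f)) =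
      ∫ q, inner ℂ (e' q) (e (x⁻¹ • q)) *
        inner ℂ f' (leftReg Measure.count (s.cocycle x⁻¹ q)⁻¹ f) ∂ν := by
  have hone := h.integral_mul_inner_leftReg_lift (w := 1) (C := 1) measurable_one (by simp)
    x e e' f f'
  simpa only [L2.inner_def, Pi.one_apply, one_mul] using hone

/-- The restriction of `u` to the translate `Ωγ` of the fundamental domain. -/
def slice (u : L2 μ) (γ : Γ) : L2 ν :=
  (((Lp.memLp u).restrict _).comp_measurePreserving (h.measurePreserving_slice γ)).toLp
    (fun q => u (s q * γ))

theorem coeFn_slice (u : L2 μ) (γ : Γ) : h.slice u γ =ᵐ[ν] fun q => u (s q * γ) :=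
  MemLp.coeFn_toLp _

theorem inner_lift_indicatorConstLp (e : L2 ν) (γ : Γ) (u : L2 μ) :
    inner ℂ (h.lift e (indicatorConstLp 2 (measurableSet_singleton γ) (by simp) 1)) u =
      inner ℂ e (h.slice u γ) := by
  let δ : L2 (Measure.count : Measure Γ) :=
    indicatorConstLp 2 (measurableSet_singleton γ) (by simp) 1
  have hδ (γ' : Γ) : δ γ' = ({γ} : Set Γ).indicator 1 γ' :=
    Measure.ae_count_iff.1 indicatorConstLp_coeFn γ'
  have hae : (fun y => inner ℂ (h.lift e δ y) (u y)) =ᵐ[μ]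
      fun y => inner ℂ (e (QuotientGroup.mk y) * δ (s.latticePart y)) (u y) := by
    filter_upwards [h.coeFn_lift e δ] with y hy
    rw [hy]
  rw [L2.inner_def, integral_congr_ae hae,
    h.integral_eq ((L2.integrable_inner (h.lift e δ) u).congr hae), L2.inner_def]
  refine integral_congr_ae ?_
  filter_upwards [h.coeFn_slice u γ] with q hq
  have hsupport : (fun γ' : Γ => inner ℂ (e q * δ γ') (u (s q * γ'))) =
      ({γ} : Set Γ).indicator fun γ' => inner ℂ (e q) (u (s q * γ')) := by
    funext γ'
    by_cases hγ : γ' ∈ ({γ} : Set Γ) <;> simp [hδ, hγ]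
  simp only [s.mk_toFun_mul_coe, s.latticePart_toFun_mul_coe, hsupport, hq]
  rw [integral_indicator (measurableSet_singleton γ), integral_singleton]
  simp [Measure.real]

theorem eq_zero_of_slice_eq_zero {u : L2 μ} (hu : ∀ γ, h.slice u γ = 0) : u = 0 := by
  have hslice : ∀ᵐ q ∂ν, ∀ γ : Γ, u (s q * γ) = 0 := by
    refine ae_all_iff.2 fun γ => ?_
    filter_upwards [h.coeFn_slice u γ, Lp.eq_zero_iff_ae_eq_zero.1 (hu γ)] with q hq hq0
    rw [← hq, hq0, Pi.zero_apply]
  rw [← inner_self_eq_zero (𝕜 := ℂ), L2.inner_def, h.integral_eq (L2.integrable_inner u u)]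
  refine integral_eq_zero_of_ae ?_
  filter_upwards [hslice] with q hq
  simp [hq]

theorem eq_zero_of_inner_lift_eq_zero {u : L2 μ} (hu : ∀ e f, inner ℂ (h.lift e f) u = 0) :
    u = 0 :=
  h.eq_zero_of_slice_eq_zero fun γ => inner_self_eq_zero.1
    ((h.inner_lift_indicatorConstLp (h.slice u γ) γ u).symm.trans (hu _ _))

theorem topologicalClosure_iSup_range_liftBasis {ι : Type*} (b : HilbertBasis ι ℂ (L2 ν)) :
    (⨆ i, (h.liftBasis b i).toLinearMap.range).topologicalClosure = ⊤ := by
  rw [Submodule.topologicalClosure_eq_top_iff, Submodule.eq_bot_iff]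
  intro u hu
  refine h.eq_zero_of_inner_lift_eq_zero fun e f => ?_
  have hzero : innerSL ℂ u ∘L h.lift.flip f = 0 := by
    refine ContinuousLinearMap.ext_on (Submodule.dense_iff_topologicalClosure_eq_top.2 b.dense_span)
      ?_
    rintro _ ⟨i, rfl⟩
    exact Submodule.inner_left_of_mem_orthogonal
      (Submodule.mem_iSup_of_mem i (LinearMap.mem_range_self _ f)) hu
  rw [← inner_conj_symm]
  exact (congrArg (starRingEnd ℂ) (DFunLike.congr_fun hzero e)).trans (map_zero _)

end IsQuotientMeasure

end FundamentalDomain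

section Transposed

variable {G : Type*} [Group G] [TopologicalSpace G] [MeasurableSpace G] [MeasurableMul G]
  {μ : Measure G} [μ.IsMulLeftInvariant] {φ : G → ℂ} {Φ : groupVN μ →ₗ[ℂ] groupVN μ}

theorem IsTransposedMul.exists_normalFunctional (hφ : φ ∈ multipliers μ)
    (hΦ : IsTransposedMul μ φ Φ) {ω : groupVN μ →L[ℂ] ℂ} (hω : ω ∈ normalFunctionals (groupVN μ)) :
    ∃ ω' ∈ normalFunctionals (groupVN μ),
      (∀ x, ω' (leftRegVN μ x) = φ x * ω (leftRegVN μ x)) ∧ ∀ T, ω (Φ T) = ω' T := by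
  obtain ⟨ω', hω', heq⟩ := mem_fourierAlgebra_iff.1
    (hφ.2 _ (mem_fourierAlgebra_iff.2 ⟨ω, hω, fun _ => rfl⟩))
  exact ⟨ω', hω', heq, isTransposedMul_iff.1 hΦ ω hω ω' hω' heq⟩

theorem IsTransposedMul.norm_le_of_cbBound (hφ : φ ∈ multipliers μ) (hΦ : IsTransposedMul μ φ Φ)
    {C : ℝ} (hC : 0 ≤ C) (hcb : CBBound Φ C) {f : L2 μ} (hf : ‖f‖ = 1) (x : G) : ‖φ x‖ ≤ C := by
  let ω := vectorFunctional (groupVN μ) (leftReg μ x f) f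
  obtain ⟨ω', -, hω'φ, hω'⟩ := hΦ.exists_normalFunctional hφ
    (vectorFunctional_mem_normalFunctionals (groupVN μ) f (leftReg μ x f))
  have hω : ω (leftRegVN μ x) = 1 := by
    simp only [ω, vectorFunctional_apply, coe_leftRegVN]
    rw [inner_self_eq_norm_sq_to_K, norm_leftReg_apply, hf]
    simp
  have hval : φ x = ω (Φ (leftRegVN μ x)) := by
    rw [hω', hω'φ]
    exact ((congrArg (φ x * ·) hω).trans (mul_one _)).symm
  calc ‖φ x‖ ≤ ‖Φ (leftRegVN μ x)‖ * (‖f‖ * ‖leftReg μ x f‖) := by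
        rw [hval]
        exact norm_inner_apply_le (Φ (leftRegVN μ x) : L2 μ →L[ℂ] L2 μ) f (leftReg μ x f)
    _ = ‖Φ (leftRegVN μ x)‖ := by rw [norm_leftReg_apply, hf, mul_one, mul_one]
    _ ≤ C * ‖leftRegVN μ x‖ := hcb.norm_apply_le hC _
    _ ≤ C := mul_le_of_le_one_right hC (norm_leftReg_le μ x)

end Transposed

section Lattice

variable {G : Type*} [Group G] [MeasurableSpace G] [MeasurableMul₂ G] [MeasurableInv G]
  {Γ : Subgroup G} {s : BorelSection Γ} {μ : Measure G} {ν : Measure (G ⧸ Γ)}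
  (h : IsQuotientMeasure s μ ν)

variable [Countable Γ] [MeasurableSingletonClass Γ] in
/-- The `(e', e)` entry of `λ(x)` under `L²(G) ≃ L²(G ⧸ Γ) ⊗ ℓ²(Γ)`. -/
def BorelSection.cocycleAverage (s : BorelSection Γ) (x : G) (e e' : L2 ν) :
    groupVN (Measure.count : Measure Γ) :=
  ∫ q, inner ℂ (e' q) (e (x⁻¹ • q)) • leftRegVN Measure.count (s.cocycle x⁻¹ q)⁻¹ ∂ν

namespace IsQuotientMeasure

/-- The constant function `1` in `L²(G ⧸ Γ)`. -/
def oneL2 : L2 ν :=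
  haveI := h.isProbabilityMeasure
  indicatorConstLp 2 MeasurableSet.univ (measure_ne_top ν _) 1

theorem coeFn_oneL2 : h.oneL2 =ᵐ[ν] 1 := by
  have := h.isProbabilityMeasure
  exact indicatorConstLp_coeFn.trans
    (Eventually.of_forall fun q => Set.indicator_of_mem (Set.mem_univ q) _)

theorem norm_oneL2 : ‖h.oneL2‖ = 1 := by
  have := h.isProbabilityMeasure
  rw [oneL2, norm_indicatorConstLp two_ne_zero ENNReal.ofNat_ne_top]
  simp

include h in
theorem integrable_inner_smul (x : G) (e e' : L2 ν) :
    Integrable (fun q => inner ℂ (e' q) (e (x⁻¹ • q))) ν := by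
  have := h.smulInvariantMeasure
  have hx := measurePreserving_smul x⁻¹ ν
  refine (L2.integrable_inner (𝕜 := ℂ) e' (Lp.compMeasurePreserving _ hx e)).congr ?_
  filter_upwards [Lp.coeFn_compMeasurePreserving e hx] with q hq
  rw [hq]
  rfl

variable [Countable Γ] [MeasurableSingletonClass Γ]

include h in
theorem apply_cocycleAverage (ω : groupVN (Measure.count : Measure Γ) →L[ℂ] ℂ) (x : G)
    (e e' : L2 ν) : ω (s.cocycleAverage x e e') =
      ∫ q, inner ℂ (e' q) (e (x⁻¹ • q)) *
        ω (leftRegVN Measure.count (s.cocycle x⁻¹ q)⁻¹) ∂ν := by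
  have : CompleteSpace (groupVN (Measure.count : Measure Γ)) := completeSpace_centralizer _
  have hm : AEStronglyMeasurable
      (fun q => leftRegVN (Measure.count : Measure Γ) (s.cocycle x⁻¹ q)⁻¹) ν :=
    ((StronglyMeasurable.of_discrete (f := leftRegVN (Measure.count : Measure Γ))).comp_measurable
      (s.measurable_cocycle x⁻¹).inv).aestronglyMeasurable
  have hint := (h.integrable_inner_smul x e e').smul_bdd 1 hm
    (Eventually.of_forall fun q => norm_leftReg_le _ _)
  exact (ω.integral_comp_comm hint).symm.trans
    (integral_congr_ae (Eventually.of_forall fun q => ω.map_smul _ _))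

variable [μ.IsMulLeftInvariant]

theorem inner_cocycleAverage (x : G) (e e' : L2 ν) (f f' : L2 (Measure.count : Measure Γ)) :
    inner ℂ f' ((s.cocycleAverage x e e' : _ →L[ℂ] L2 (Measure.count : Measure Γ)) f) =
      inner ℂ (h.lift e' f') (leftReg μ x (h.lift e f)) :=
  (h.apply_cocycleAverage (vectorFunctional _ f' f) x e e').trans
    (h.inner_leftReg_lift x e e' f f').symm

theorem coord_comp_comp_mem_groupVN {ι : Type*} (b : HilbertBasis ι ℂ (L2 ν)) (i j : ι)
    (T : L2 μ →L[ℂ] L2 μ) (hT : T ∈ groupVN μ) :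
    coord (h.liftBasis b) i ∘L T ∘L (h.liftBasis b j).toContinuousLinearMap ∈
      groupVN (Measure.count : Measure Γ) := by
  refine coord_comp_comp_mem_centralizer fun R hR f g => ?_
  have heq := normalFunctional_ext
    (vectorFunctional_mem_normalFunctionals (groupVN μ) (h.liftBasis b j f)
      (h.liftBasis b i (star R g)))
    (vectorFunctional_mem_normalFunctionals (groupVN μ) (h.liftBasis b j (R f))
      (h.liftBasis b i g))
    fun x => by
      simp only [vectorFunctional_apply, coe_leftRegVN, liftBasis_apply, inner_leftReg_lift,
        inner_star_apply_leftReg hR]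
  exact DFunLike.congr_fun heq ⟨T, hT⟩

theorem represents_hat {φ : Γ → ℂ} {f g : ℕ → L2 (Measure.count : Measure Γ)}
    (hφ : Represents Measure.count φ f g) :
    Represents μ (hat μ Γ s.domain φ) (fun n => h.lift h.oneL2 (f n))
      (fun n => h.lift h.oneL2 (g n)) := by
  have := h.smulInvariantMeasure
  obtain ⟨ω, -, hω, hωφ⟩ := hφ.exists_normalFunctional
  refine ⟨by simpa only [norm_lift, norm_oneL2, one_mul] using hφ.1, fun x => ?_⟩
  have hone : ∀ᵐ q ∂ν, inner ℂ (h.oneL2 q) (h.oneL2 (x⁻¹ • q)) = (1 : ℂ) := by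
    filter_upwards [h.coeFn_oneL2,
      (measurePreserving_smul x⁻¹ ν).quasiMeasurePreserving.ae h.coeFn_oneL2] with q hq hxq
    simp [hq, hxq]
  calc hat μ Γ s.domain φ x
      = ∫ q, φ (s.cocycle x⁻¹ q)⁻¹ ∂ν := (h.integral_cocycle_inv φ x).symm
    _ = ω (s.cocycleAverage x h.oneL2 h.oneL2) := by
        rw [h.apply_cocycleAverage]
        refine integral_congr_ae ?_
        filter_upwards [hone] with q hq
        rw [hq, one_mul, hωφ]
    _ = ∑' n, inner ℂ (h.lift h.oneL2 (g n)) (leftReg μ x (h.lift h.oneL2 (f n))) :=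
        (hω _).trans (tsum_congr fun n => h.inner_cocycleAverage x _ _ _ _)

include h in
theorem hat_mem_fourierAlgebra {φ : Γ → ℂ} (hφ : φ ∈ fourierAlgebra (Measure.count : Measure Γ)) :
    hat μ Γ s.domain φ ∈ fourierAlgebra μ := by
  obtain ⟨f, g, hfg⟩ := hφ
  exact ⟨_, _, h.represents_hat hfg⟩

include h in
theorem fourierNorm_hat_le {φ : Γ → ℂ} (hφ : φ ∈ fourierAlgebra (Measure.count : Measure Γ)) :
    fourierNorm μ (hat μ Γ s.domain φ) ≤ fourierNorm Measure.count φ := by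
  obtain ⟨f₀, g₀, hfg₀⟩ := hφ
  refine csInf_le_csInf ⟨0, ?_⟩ ⟨_, f₀, g₀, hfg₀, rfl⟩ ?_
  · rintro _ ⟨f, g, -, rfl⟩
    exact tsum_nonneg fun n => by positivity
  · rintro _ ⟨f, g, hfg, rfl⟩
    exact ⟨_, _, h.represents_hat hfg, by simp only [norm_lift, norm_oneL2, one_mul]⟩

theorem entry_leftRegVN {ι : Type*} (b : HilbertBasis ι ℂ (L2 ν)) (i j : ι) (x : G) :
    entry (h.coord_comp_comp_mem_groupVN b) i j (leftRegVN μ x) =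
      s.cocycleAverage x (b j) (b i) :=
  Subtype.ext <| ContinuousLinearMap.ext fun f => ext_inner_left ℂ fun g =>
    (inner_entry_apply _ i j _ g f).trans (h.inner_cocycleAverage x (b j) (b i) f g).symm

theorem apply_cocycleAverage_of_mul {φ : Γ → ℂ} {C : ℝ} (hφ : ∀ γ, ‖φ γ‖ ≤ C)
    {f f' : L2 (Measure.count : Measure Γ)} {ω : groupVN (Measure.count : Measure Γ) →L[ℂ] ℂ}
    (hω : ∀ γ, ω (leftRegVN Measure.count γ) = φ γ * inner ℂ f' (leftReg Measure.count γ f))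
    (x : G) (e e' : L2 ν) :
    ω (s.cocycleAverage x e e') = ∫ y, φ (s.cocycle x⁻¹ (QuotientGroup.mk y))⁻¹ *
      inner ℂ (h.lift e' f' y) (leftReg μ x (h.lift e f) y) ∂μ := by
  rw [h.integral_mul_inner_leftReg_lift (w := fun q => φ (s.cocycle x⁻¹ q)⁻¹)
    ((measurable_of_countable φ).comp (s.measurable_cocycle x⁻¹).inv) (fun q => hφ _),
    h.apply_cocycleAverage]
  congr 1
  funext q
  rw [hω]
  ring

include h in
/-- The amplification of `m_φ^*` to `B(L²(G ⧸ Γ)) ⊗ M(Γ)`, restricted to `M(G)`, multiplies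
`λ(x)` by the values of `φ` on the cocycle. -/
theorem exists_amplified_transposedMul [TopologicalSpace Γ] {φ : Γ → ℂ}
    (hφ : φ ∈ multipliers (Measure.count : Measure Γ))
    {Φ : groupVN (Measure.count : Measure Γ) →ₗ[ℂ] groupVN (Measure.count : Measure Γ)} {C : ℝ}
    (hC : 0 ≤ C) (hφC : ∀ γ, ‖φ γ‖ ≤ C) (hΦ : IsTransposedMul Measure.count φ Φ)
    (hcb : CBBound Φ C) :
    ∃ Λ : L2 μ →L⋆[ℂ] L2 μ →L[ℂ] (groupVN μ →L[ℂ] ℂ), IsCBForm Λ C ∧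
      (∀ v u, Λ v u ∈ normalFunctionals (groupVN μ)) ∧
      ∀ x v u, Λ v u (leftRegVN μ x) =
        ∫ y, φ (s.cocycle x⁻¹ (QuotientGroup.mk y))⁻¹ * inner ℂ (v y) (leftReg μ x u y) ∂μ := by
  obtain ⟨ι, b, -⟩ := exists_hilbertBasis ℂ (L2 ν)
  have hcoeff (g f) := hΦ.exists_normalFunctional hφ
    (vectorFunctional_mem_normalFunctionals (groupVN (Measure.count : Measure Γ)) f g)
  refine (exists_normal_amplification (h.coord_comp_comp_mem_groupVN b)
    (h.orthogonalFamily_liftBasis b) (h.topologicalClosure_iSup_range_liftBasis b) rfl hC hcb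
    fun g f => (hcoeff g f).imp fun _ hω => ⟨hω.1, hω.2.2⟩).imp
    fun Λ hΛ => ⟨hΛ.1, hΛ.2.1, fun x v u => ?_⟩
  have hw : Measurable fun y : G => φ (s.cocycle x⁻¹ (QuotientGroup.mk y))⁻¹ :=
    (measurable_of_countable φ).comp
      ((s.measurable_cocycle x⁻¹).inv.comp QuotientGroup.measurable_coe)
  have hwC (y : G) : ‖φ (s.cocycle x⁻¹ (QuotientGroup.mk y))⁻¹‖ ≤ C := hφC _
  refine (hΛ.2.2 _ (mulOp hw hwC ∘L leftReg μ x) (fun i j g f => ?_) v u).trans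
    (inner_mulOp hw hwC _ _)
  rw [h.entry_leftRegVN b i j x]
  exact (hcoeff g f).elim fun ω hω => (hω.2.2 _).trans <|
    (h.apply_cocycleAverage_of_mul hφC hω.2.1 x (b j) (b i)).trans (inner_mulOp hw hwC _ _).symm

end IsQuotientMeasure

end Lattice

section Continuity

variable {G : Type*} [Group G] [TopologicalSpace G] [IsTopologicalGroup G]
  [LocallyCompactSpace G] [SecondCountableTopology G] [MeasurableSpace G] [BorelSpace G]
  {μ : Measure G} [μ.IsHaarMeasure]

theorem continuous_leftReg_apply (f : L2 μ) : Continuous fun x => leftReg μ x f := by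
  let m : C(G × G, G) := ⟨fun p => p.1⁻¹ * p.2, by fun_prop⟩
  exact Continuous.compMeasurePreservingLp (f := fun _ : G => f) (g := fun x => m.curry x)
    continuous_const m.curry.continuous (fun x => measurePreserving_mul_left μ x⁻¹)
    ENNReal.ofNat_ne_top

theorem continuous_of_mem_fourierAlgebra {ψ : G → ℂ} (hψ : ψ ∈ fourierAlgebra μ) :
    Continuous ψ := by
  obtain ⟨f, g, hfg, hψ⟩ := hψ
  rw [funext hψ]
  exact continuous_tsum (fun n => continuous_const.inner (continuous_leftReg_apply (f n))) hfg
    fun n x => (norm_inner_apply_le _ _ _).trans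
      (mul_le_of_le_one_left (by positivity) (norm_leftReg_le μ x))

theorem continuous_of_forall_mul_mem {φ : G → ℂ} {u : L2 μ} (hu : u ≠ 0)
    (h : ∀ v : L2 μ, (fun x => φ x * inner ℂ v (leftReg μ x u)) ∈ fourierAlgebra μ) :
    Continuous φ := by
  refine continuous_iff_continuousAt.2 fun x₀ => ?_
  have hcoeff : ContinuousAt (fun x => (inner ℂ (leftReg μ x₀ u) (leftReg μ x u) : ℂ)) x₀ :=
    (continuous_const.inner (continuous_leftReg_apply u)).continuousAt
  have hne : (inner ℂ (leftReg μ x₀ u) (leftReg μ x₀ u) : ℂ) ≠ 0 := by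
    rwa [inner_self_ne_zero, ← norm_ne_zero_iff, norm_leftReg_apply, norm_ne_zero_iff]
  have hmul := (continuous_of_mem_fourierAlgebra (h (leftReg μ x₀ u))).continuousAt (x := x₀)
  refine (hmul.div hcoeff hne).congr ?_
  filter_upwards [hcoeff.eventually_ne hne] with x hx
  exact mul_div_cancel_right₀ _ hx

theorem mem_multipliers_of_map_leftRegVN {φ : G → ℂ} {u : L2 μ} (hu : u ≠ 0)
    {Ψ : groupVN μ →ₗ[ℂ] groupVN μ}
    (hnormal : ∀ ω ∈ normalFunctionals (groupVN μ),
      ∃ ω' ∈ normalFunctionals (groupVN μ), ∀ T, ω (Ψ T) = ω' T)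
    (hφ : ∀ x, Ψ (leftRegVN μ x) = φ x • leftRegVN μ x) :
    φ ∈ multipliers μ ∧ IsTransposedMul μ φ Ψ := by
  have hmul {ω ω' : groupVN μ →L[ℂ] ℂ} (hω : ∀ T, ω (Ψ T) = ω' T) (x : G) :
      ω' (leftRegVN μ x) = φ x * ω (leftRegVN μ x) :=
    (hω _).symm.trans ((congrArg ω (hφ x)).trans (ω.map_smul _ _))
  have hmem (ψ) (hψ : ψ ∈ fourierAlgebra μ) : (fun x => φ x * ψ x) ∈ fourierAlgebra μ := by
    obtain ⟨ω, hω, hωψ⟩ := mem_fourierAlgebra_iff.1 hψ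
    obtain ⟨ω', hω', heq⟩ := hnormal ω hω
    exact mem_fourierAlgebra_iff.2 ⟨ω', hω', fun x => by rw [hmul heq, hωψ]⟩
  refine ⟨⟨continuous_of_forall_mul_mem hu fun v => hmem _ (mem_fourierAlgebra_iff.2
    ⟨_, vectorFunctional_mem_normalFunctionals _ u v, fun _ => rfl⟩), hmem⟩,
    isTransposedMul_iff.2 fun ω hω ω' hω' heq T => ?_⟩
  obtain ⟨ω'', hω'', heq'⟩ := hnormal ω hω
  rw [heq', normalFunctional_ext hω'' hω' fun x => (hmul heq' x).trans (heq x).symm]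

theorem exists_isTransposedMul_of_form {φ : G → ℂ} {u₀ : L2 μ} (hu₀ : u₀ ≠ 0) {C : ℝ}
    (hC : 0 ≤ C) {Θ : L2 μ →L⋆[ℂ] L2 μ →L[ℂ] (groupVN μ →L[ℂ] ℂ)} (hΘ : IsCBForm Θ C)
    (hN : ∀ v u, Θ v u ∈ normalFunctionals (groupVN μ))
    (hφ : ∀ x v u, Θ v u (leftRegVN μ x) = φ x * inner ℂ v (leftReg μ x u)) :
    φ ∈ multipliers μ ∧ ∃ Ψ, IsTransposedMul μ φ Ψ ∧ CBBound Ψ C := by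
  have hcomm (R) (hR : R ∈ StarSubalgebra.centralizer ℂ (groupVN μ : Set (L2 μ →L[ℂ] L2 μ)))
      (v u) : Θ (star R v) u = Θ v (R u) :=
    normalFunctional_ext (hN _ _) (hN _ _) fun x => by
      rw [hφ, hφ, inner_star_apply_leftReg hR]
  refine (exists_map_of_form rfl hcomm).elim fun Ψ hΨ => ?_
  have hval (x) : Ψ (leftRegVN μ x) = φ x • leftRegVN μ x :=
    Subtype.ext <| ContinuousLinearMap.ext fun u => ext_inner_left ℂ fun v =>
      (hΨ _ v u).trans ((hφ x v u).trans (inner_smul_right _ _ _).symm)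
  have hmul := mem_multipliers_of_map_leftRegVN hu₀
    (fun ω hω => exists_normalFunctional_of_form hΨ rfl hN hω) hval
  exact ⟨hmul.1, Ψ, hmul.2, hΘ.cbBound hΨ hC⟩

end Continuity

section RightTranslation

variable {G : Type*} [Group G] [MeasurableSpace G] [MeasurableMul G]
  (μ : Measure G) [μ.IsMulRightInvariant]

/-- The right translation `(R(z) u)(y) = u(y z⁻¹)` on `L²(G, μ)`, for a right invariant `μ`. -/
def rightTranslate (z : G) : L2 μ →ₗᵢ[ℂ] L2 μ :=
  Lp.compMeasurePreservingₗᵢ ℂ (fun y : G => y * z⁻¹) (measurePreserving_mul_right μ z⁻¹)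

theorem coeFn_rightTranslate (z : G) (u : L2 μ) :
    rightTranslate μ z u =ᵐ[μ] fun y => u (y * z⁻¹) :=
  Lp.coeFn_compMeasurePreserving u (measurePreserving_mul_right μ z⁻¹)

theorem leftReg_rightTranslate [μ.IsMulLeftInvariant] (x z : G) (u : L2 μ) :
    leftReg μ x (rightTranslate μ z u) = rightTranslate μ z (leftReg μ x u) := by
  refine Lp.ext ?_
  have hright := (measurePreserving_mul_left μ x⁻¹).quasiMeasurePreserving.ae
    (coeFn_rightTranslate μ z u)
  have hleft := (measurePreserving_mul_right μ z⁻¹).quasiMeasurePreserving.ae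
    (coeFn_leftReg μ x u)
  filter_upwards [hright, hleft, coeFn_leftReg μ x (rightTranslate μ z u),
    coeFn_rightTranslate μ z (leftReg μ x u)] with y h₁ h₂ h₃ h₄
  rw [h₃, h₁, h₄, h₂, mul_assoc]

theorem continuous_rightTranslate_apply [TopologicalSpace G] [IsTopologicalGroup G]
    [LocallyCompactSpace G] [SecondCountableTopology G] [BorelSpace G] [μ.IsHaarMeasure]
    (u : L2 μ) : Continuous fun z => rightTranslate μ z u := by
  let m : C(G × G, G) := ⟨fun p => p.2 * p.1⁻¹, by fun_prop⟩
  exact Continuous.compMeasurePreservingLp (f := fun _ : G => u) (g := fun z => m.curry z)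
    continuous_const m.curry.continuous (fun z => measurePreserving_mul_right μ z⁻¹)
    ENNReal.ofNat_ne_top

theorem integral_mul_inner_rightTranslate {w : G → ℂ} (z : G) (v u : L2 μ) :
    ∫ y, w y * inner ℂ (rightTranslate μ z v y) (rightTranslate μ z u y) ∂μ =
      ∫ y, w (y * z) * inner ℂ (v y) (u y) ∂μ := by
  rw [← integral_mul_right_eq_self (fun y => w (y * z) * inner ℂ (v y) (u y)) z⁻¹]
  refine integral_congr_ae ?_
  filter_upwards [coeFn_rightTranslate μ z u, coeFn_rightTranslate μ z v] with y hu hv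
  rw [hu, hv, inv_mul_cancel_right]

end RightTranslation

theorem exists_L2_norm_eq_one {X : Type*} [MeasurableSpace X] {μ : Measure X} {A : Set X}
    (hA : MeasurableSet A) (hμA : μ A = 1) : ∃ f : L2 μ, ‖f‖ = 1 :=
  ⟨indicatorConstLp 2 hA (by simp [hμA]) 1, by
    rw [norm_indicatorConstLp two_ne_zero ENNReal.ofNat_ne_top]
    simp [Measure.real, hμA]⟩

namespace IsQuotientMeasure

section Mean

variable {G : Type*} [Group G] [MeasurableSpace G] [MeasurableMul₂ G] [MeasurableInv G]
  {Γ : Subgroup G} [Countable Γ] [MeasurableSingletonClass Γ] {s : BorelSection Γ}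
  {μ : Measure G} {ν : Measure (G ⧸ Γ)} (h : IsQuotientMeasure s μ ν)

include h

theorem integral_domain_mul {w : G ⧸ Γ → ℂ} (hw : Measurable w) (y : G) :
    ∫ z in s.domain, w (QuotientGroup.mk (y * z)) ∂μ = ∫ q, w q ∂ν := by
  have := h.smulInvariantMeasure
  calc ∫ z in s.domain, w (QuotientGroup.mk (y * z)) ∂μ = ∫ q, w (y • q) ∂ν := by
        rw [← h.measurePreserving_mk.map_eq]
        exact (integral_map QuotientGroup.measurable_coe.aemeasurable
          (hw.comp (measurable_const_smul y)).aestronglyMeasurable).symm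
    _ = ∫ q, w q ∂ν := (measurePreserving_smul y ν).integral_comp
        (MeasurableEquiv.smul y).measurableEmbedding w

/-- Averaging over right translations by the fundamental domain replaces a weight on `G ⧸ Γ` by
its mean. -/
theorem integral_domain_mul_inner_rightTranslate [SFinite μ] [μ.IsMulRightInvariant]
    [IsFiniteMeasure (μ.restrict s.domain)] {w : G ⧸ Γ → ℂ} {C : ℝ} (hw : Measurable w)
    (hC : ∀ q, ‖w q‖ ≤ C) (v u : L2 μ) :
    ∫ z in s.domain, ∫ y, w (QuotientGroup.mk y) *
      inner ℂ (rightTranslate μ z v y) (rightTranslate μ z u y) ∂μ ∂μ =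
      (∫ q, w q ∂ν) * inner ℂ v u := by
  have hm : Measurable fun p : G × G => w (QuotientGroup.mk (p.2 * p.1)) :=
    hw.comp (QuotientGroup.measurable_coe.comp (measurable_snd.mul measurable_fst))
  have hint : Integrable (Function.uncurry fun z y => w (QuotientGroup.mk (y * z)) *
      inner ℂ (v y) (u y)) ((μ.restrict s.domain).prod μ) :=
    ((L2.integrable_inner (𝕜 := ℂ) v u).comp_snd _).bdd_mul hm.aestronglyMeasurable
      (Eventually.of_forall fun p => hC _)
  simp only [integral_mul_inner_rightTranslate μ (w := fun y => w (QuotientGroup.mk y))]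
  rw [integral_integral_swap hint]
  simp only [integral_mul_const, h.integral_domain_mul hw, integral_const_mul, L2.inner_def]

end Mean

section Multiplier

variable {G : Type*} [Group G] [TopologicalSpace G] [IsTopologicalGroup G]
  [LocallyCompactSpace G] [SecondCountableTopology G] [MeasurableSpace G] [BorelSpace G]
  {Γ : Subgroup G} [Countable Γ] [MeasurableSingletonClass Γ] {s : BorelSection Γ}
  {μ : Measure G} [μ.IsHaarMeasure] {ν : Measure (G ⧸ Γ)} (h : IsQuotientMeasure s μ ν)
  (hμ : μ s.domain = 1)

include h hμ

theorem exists_form_hat {φ : Γ → ℂ} {C : ℝ} (hφC : ∀ γ, ‖φ γ‖ ≤ C)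
    {Λ : L2 μ →L⋆[ℂ] L2 μ →L[ℂ] (groupVN μ →L[ℂ] ℂ)} (hΛ : IsCBForm Λ C)
    (hN : ∀ v u, Λ v u ∈ normalFunctionals (groupVN μ))
    (hφ : ∀ x v u, Λ v u (leftRegVN μ x) =
      ∫ y, φ (s.cocycle x⁻¹ (QuotientGroup.mk y))⁻¹ * inner ℂ (v y) (leftReg μ x u y) ∂μ) :
    ∃ Θ : L2 μ →L⋆[ℂ] L2 μ →L[ℂ] (groupVN μ →L[ℂ] ℂ), IsCBForm Θ C ∧
      (∀ v u, Θ v u ∈ normalFunctionals (groupVN μ)) ∧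
      ∀ x v u, Θ v u (leftRegVN μ x) =
        hat μ Γ s.domain φ x * inner ℂ v (leftReg μ x u) := by
  have := h.isMulRightInvariant hμ
  have : IsProbabilityMeasure (μ.restrict s.domain) := ⟨by simp [hμ]⟩
  refine (exists_averaged_normal_form (μ.restrict s.domain) (continuous_rightTranslate_apply μ)
    rfl hΛ hN).imp fun Θ hΘ => ⟨hΘ.1, hΘ.2.1, fun x v u => (hΘ.2.2 _ v u).trans <|
      (integral_congr_ae (Eventually.of_forall fun z => hφ x _ _)).trans ?_⟩
  simp only [leftReg_rightTranslate]
  rw [h.integral_domain_mul_inner_rightTranslate (w := fun q => φ (s.cocycle x⁻¹ q)⁻¹)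
    ((measurable_of_countable φ).comp (s.measurable_cocycle x⁻¹).inv) (fun q => hφC _),
    h.integral_cocycle_inv]

theorem hat_mem_multipliers {φ : Γ → ℂ} (hφ : φ ∈ multipliers (Measure.count : Measure Γ))
    {Φ : groupVN (Measure.count : Measure Γ) →ₗ[ℂ] groupVN (Measure.count : Measure Γ)} {C : ℝ}
    (hC : 0 ≤ C) (hΦ : IsTransposedMul Measure.count φ Φ) (hcb : CBBound Φ C) :
    hat μ Γ s.domain φ ∈ multipliers μ ∧
      ∃ Ψ, IsTransposedMul μ (hat μ Γ s.domain φ) Ψ ∧ CBBound Ψ C := by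
  obtain ⟨δ, hδ⟩ := exists_L2_norm_eq_one (measurableSet_singleton (1 : Γ))
    (Measure.count_singleton 1)
  obtain ⟨u₀, hu₀⟩ := exists_L2_norm_eq_one s.measurableSet_domain hμ
  have hφC (γ : Γ) : ‖φ γ‖ ≤ C := hΦ.norm_le_of_cbBound hφ hC hcb hδ γ
  exact (h.exists_amplified_transposedMul hφ hC hφC hΦ hcb).elim fun Λ hΛ =>
    (h.exists_form_hat hμ hφC hΛ.1 hΛ.2.1 hΛ.2.2).elim fun Θ hΘ =>
      exists_isTransposedMul_of_form (norm_ne_zero_iff.1 (hu₀.trans_ne one_ne_zero)) hC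
        hΘ.1 hΘ.2.1 hΘ.2.2

theorem hat_mem_cbMultipliers {φ : Γ → ℂ} (hφ : φ ∈ cbMultipliers (Measure.count : Measure Γ)) :
    hat μ Γ s.domain φ ∈ cbMultipliers μ := by
  obtain ⟨hφ, Φ, C, hΦ, hC, hcb⟩ := hφ
  obtain ⟨hhat, Ψ, hΨ, hΨcb⟩ := h.hat_mem_multipliers hμ hφ hC hΦ hcb
  exact ⟨hhat, Ψ, C, hΨ, hC, hΨcb⟩

theorem cbMultiplierNorm_hat_le {φ : Γ → ℂ}
    (hφ : φ ∈ cbMultipliers (Measure.count : Measure Γ)) :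
    cbMultiplierNorm μ (hat μ Γ s.domain φ) ≤ cbMultiplierNorm Measure.count φ := by
  obtain ⟨hφ, Φ₀, C₀, hΦ₀, hC₀, hcb₀⟩ := hφ
  refine csInf_le_csInf ⟨0, fun _ hC => hC.1⟩ ⟨C₀, hC₀, Φ₀, hΦ₀, hcb₀⟩ ?_
  rintro C ⟨hC, Φ, hΦ, hcb⟩
  exact ⟨hC, (h.hat_mem_multipliers hμ hφ hC hΦ hcb).2⟩

end Multiplier

end IsQuotientMeasure

end

end FourierLattice

open FourierLattice in
theorem lemma2p1 {G : Type*} [Group G] [TopologicalSpace G] [IsTopologicalGroup G]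
    [LocallyCompactSpace G] [T2Space G] [SecondCountableTopology G]
    [MeasurableSpace G] [BorelSpace G]
    (Γ : Subgroup G) (hΓ : IsLattice Γ)
    (Ω : Set G) (hΩ : IsBorelFundamentalDomain Γ Ω)
    (μ : Measure G) [μ.IsHaarMeasure] (hμ : μ Ω = 1) :
    (∀ φ : Γ → ℂ, φ ∈ fourierAlgebra (Measure.count : Measure Γ) →
      hat μ Γ Ω φ ∈ fourierAlgebra μ ∧
        fourierNorm μ (hat μ Γ Ω φ) ≤ fourierNorm (Measure.count : Measure Γ) φ) ∧
    (∀ φ : Γ → ℂ, φ ∈ cbMultipliers (Measure.count : Measure Γ) →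
      hat μ Γ Ω φ ∈ cbMultipliers μ ∧
        cbMultiplierNorm μ (hat μ Γ Ω φ) ≤
          cbMultiplierNorm (Measure.count : Measure Γ) φ) := by
  obtain ⟨σ, hσ, hmk, rfl⟩ := hΩ
  have := hΓ.discrete
  have : Countable Γ := countable_of_Lindelof_of_discrete
  let s : BorelSection Γ := ⟨σ, hσ, hmk⟩
  obtain ⟨ν, h⟩ := exists_isQuotientMeasure hΓ s hμ
  exact ⟨fun φ hφ => ⟨h.hat_mem_fourierAlgebra hφ, h.fourierNorm_hat_le hφ⟩,
    fun φ hφ => ⟨h.hat_mem_cbMultipliers hμ hφ, h.cbMultiplierNorm_hat_le hμ hφ⟩⟩
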